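/- Let $(M^3,\langle\,,\rangle)$ be a complete smooth Riemannian $3$-manifold with Levi-Civita connection $\nabla^0$, and let $\mathcal V$ be a smooth unit vector field on $M^3$ that is anti-torqued with conformal scalar $f\in C^\infty(M^3)$, that is, $$\nabla^0_X\mathcal V=f\,(X-\langle X,\mathcal V\rangle\mathcal V)\quad\text{for all vector fields } X .$$ Let $\phi:N\to M^3$ be a smooth immersion of a surface with a smooth unit normal vector field $U$, and let $N$ carry the induced metric $\langle\,,\rangle_N$. Suppose that $N$ is a constant angle surface with axis $\mathcal V$: there is $\theta\in[0,\pi]$ with $\langle U,\mathcal V\rangle=\cos\theta$ on $N$, and the tangential part $\mathcal V^\top=\mathcal V-\langle\mathcal V,U\rangle U$ vanishes nowhere on $N$ (so $\sin\theta\ne0$). Then, around every point of $N$, one of the following holds. 1. $\cos\theta=0$ and $N$ is locally a ruled surface: the point has a neighbourhood in $N$ with smooth coordinates $(s,t)$ in which $\phi$ maps the coordinate lines $t=\mathrm{const}$ to geodesics of $M^3$. 2. $\cos\theta\neq0$ and the point has a neighbourhood in $N$ with smooth coordinates $(s,t)$ and a smooth function $\lambda>0$ on it such that $$\langle\,,\rangle_N=ds^2+\lambda^2dt^2,\qquad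 (\log\lambda)_s=\frac{\cos\theta\,\kappa_2+f}{\sin\theta},$$ where $\partial_t$ is a principal direction and $\kappa_2$ is the principal curvature along it, i.e. $A\,\partial_t=\kappa_2\,\partial_t$ for the shape operator $A(X)=-\nabla^0_XU$, and $f$ is evaluated along $\phi$. -/

import Mathlib

noncomputable section

namespace ConstantAngle

section EuclideanChristoffel

variable {E : Type*} [NormedAddCommGroup E] [NormedSpace ℝ E]

/-- The Christoffel symbols of the first kind at `y` of a metric `g` on an open subset of `E`:
`u ↦ ½ (∂_v g(w, u) + ∂_w g(v, u) - ∂_u g(v, w))`. -/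
def christoffelFirst (g : E → E →L[ℝ] E →L[ℝ] ℝ) (y v w : E) : E →L[ℝ] ℝ :=
  let D : E →L[ℝ] E →L[ℝ] E →L[ℝ] ℝ := fderiv ℝ g y
  (2⁻¹ : ℝ) • (D v w + D w v - (D.flip v).flip w)

end EuclideanChristoffel

end ConstantAngle

end

open Bundle
open scoped Manifold ContDiff

noncomputable section

namespace ConstantAngle

section LeviCivita

variable {E : Type*} [NormedAddCommGroup E] [NormedSpace ℝ E]
  {M : Type*} [TopologicalSpace M] [ChartedSpace E M] [IsManifold 𝓘(ℝ, E) ∞ M]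
  [RiemannianBundle (fun x : M ↦ TangentSpace 𝓘(ℝ, E) x)]

/-- The Riemannian metric of `M` written in the preferred chart around `x₀`: for `y` in the target
of that chart, the bilinear form `(v, w) ↦ g_{ij}(y) v^i w^j` on the model space `E`. -/
def metricInChart (x₀ : M) (y : E) : E →L[ℝ] E →L[ℝ] ℝ :=
  let x : M := (extChartAt 𝓘(ℝ, E) x₀).symm y
  let L : E →L[ℝ] TangentSpace 𝓘(ℝ, E) x :=
    (trivializationAt E (TangentSpace 𝓘(ℝ, E) : M → Type _) x₀).symmL ℝ x
  (innerSL ℝ (E := TangentSpace 𝓘(ℝ, E) x)).bilinearComp L L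

/-- The Christoffel symbols of the second kind at `x₀`, in the preferred chart around `x₀`:
the vector `Γ^k_{ij} v^i w^j`, obtained from those of the first kind by raising the index with the
metric. The preferred chart around `x₀` identifies the tangent space at `x₀` with `E`. -/
def christoffel [FiniteDimensional ℝ E] (x₀ : M) (v w : TangentSpace 𝓘(ℝ, E) x₀) :
    TangentSpace 𝓘(ℝ, E) x₀ :=
  haveI : FiniteDimensional ℝ (TangentSpace 𝓘(ℝ, E) x₀) :=
    inferInstanceAs (FiniteDimensional ℝ E)
  haveI : CompleteSpace (TangentSpace 𝓘(ℝ, E) x₀) := FiniteDimensional.complete ℝ _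
  (InnerProductSpace.toDual ℝ (TangentSpace 𝓘(ℝ, E) x₀)).symm
    (christoffelFirst (E := E) (metricInChart x₀) (extChartAt 𝓘(ℝ, E) x₀ x₀) v w)

variable {F : Type*} [NormedAddCommGroup F] [NormedSpace ℝ F]
  {N : Type*} [TopologicalSpace N] [ChartedSpace F N]

/-- The Levi-Civita covariant derivative `∇⁰_v Z` at `p` of a vector field `Z` along a map
`φ : N → M`, in the direction `v ∈ T_pN`. In the preferred chart around `φ p` it is
`dZ^k(v) + Γ^k_{ij} (dφ v)^i Z^j`. -/
def covDerivAlong [FiniteDimensional ℝ E] (φ : N → M) (Z : ∀ p, TangentSpace 𝓘(ℝ, E) (φ p))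
    (p : N) (v : TangentSpace 𝓘(ℝ, F) p) : TangentSpace 𝓘(ℝ, E) (φ p) :=
  let Zcoord : N → E := fun q ↦
    (trivializationAt E (TangentSpace 𝓘(ℝ, E) : M → Type _) (φ p) ⟨φ q, Z q⟩).2
  let dZ : TangentSpace 𝓘(ℝ, E) (φ p) := mfderiv 𝓘(ℝ, F) 𝓘(ℝ, E) Zcoord p v
  dZ + christoffel (φ p) (mfderiv 𝓘(ℝ, F) 𝓘(ℝ, E) φ p v) (Z p)

/-- The Levi-Civita covariant derivative `∇⁰_v V` of a vector field `V` on `M`. -/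
def covDeriv [FiniteDimensional ℝ E] (V : ∀ x : M, TangentSpace 𝓘(ℝ, E) x) (x : M)
    (v : TangentSpace 𝓘(ℝ, E) x) : TangentSpace 𝓘(ℝ, E) x :=
  covDerivAlong (F := E) (fun x : M ↦ x) V x v

/-- `γ` restricts to a (affinely parametrized) geodesic of `M` on the open set `s`. -/
def IsGeodesicOn [FiniteDimensional ℝ E] (γ : ℝ → M) (s : Set ℝ) : Prop :=
  ContMDiffOn 𝓘(ℝ, ℝ) 𝓘(ℝ, E) ∞ γ s ∧
    ∀ τ ∈ s, covDerivAlong (F := ℝ) γ (fun τ ↦ mfderiv 𝓘(ℝ, ℝ) 𝓘(ℝ, E) γ τ (1 : ℝ)) τ (1 : ℝ) = 0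

/-- `V` is a torse-forming vector field with conformal scalar `f` and generating form `η`. -/
structure IsTorseForming [FiniteDimensional ℝ E] (V : ∀ x : M, TangentSpace 𝓘(ℝ, E) x)
    (f : M → ℝ) (η : ∀ x : M, TangentSpace 𝓘(ℝ, E) x →L[ℝ] ℝ) : Prop where
  contMDiff_field : ContMDiff 𝓘(ℝ, E) 𝓘(ℝ, E).tangent ∞
    (fun x ↦ (⟨x, V x⟩ : TangentBundle 𝓘(ℝ, E) M))
  contMDiff_scalar : ContMDiff 𝓘(ℝ, E) 𝓘(ℝ, ℝ) ∞ f
  covDeriv_eq : ∀ (x : M) (v : TangentSpace 𝓘(ℝ, E) x),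
    covDeriv V x v = f x • v + η x v • V x

/-- `V` is an anti-torqued vector field with conformal scalar `f`: it is torse-forming and its
generating form is `-f` times the `1`-form dual to `V`. -/
def IsAntiTorqued [FiniteDimensional ℝ E] (V : ∀ x : M, TangentSpace 𝓘(ℝ, E) x)
    (f : M → ℝ) : Prop :=
  IsTorseForming V f (fun x ↦ -f x • innerSL ℝ (V x))

end LeviCivita

section Surface

variable {M : Type*} [TopologicalSpace M] [ChartedSpace (EuclideanSpace ℝ (Fin 3)) M]
  [IsManifold (𝓡 3) ∞ M] [RiemannianBundle (fun x : M ↦ TangentSpace (𝓡 3) x)]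
  {N : Type*} [TopologicalSpace N] [ChartedSpace (EuclideanSpace ℝ (Fin 2)) N]

/-- `φ : N → M` is a smooth immersion of a surface and `U` is a smooth unit normal vector field
along it. -/
structure IsImmersedSurface (φ : N → M) (U : ∀ p, TangentSpace (𝓡 3) (φ p)) : Prop where
  contMDiff : ContMDiff (𝓡 2) (𝓡 3) ∞ φ
  injective_mfderiv : ∀ p, Function.Injective (mfderiv (𝓡 2) (𝓡 3) φ p)
  contMDiff_normal : ContMDiff (𝓡 2) (𝓡 3).tangent ∞
    (fun p ↦ (⟨φ p, U p⟩ : TangentBundle (𝓡 3) M))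
  norm_normal : ∀ p, ‖U p‖ = 1
  inner_normal : ∀ p (v : TangentSpace (𝓡 2) p), inner ℝ (U p) (mfderiv (𝓡 2) (𝓡 3) φ p v) = 0

/-- The immersed surface `φ` with unit normal `U` is a constant angle surface with axis `V` and
angle `θ`: the tangential part `V - ⟨V, U⟩ U` of the axis vanishes nowhere, and
`⟨U, V⟩ = cos θ` along `φ`. -/
structure IsConstantAngle (φ : N → M) (U : ∀ p, TangentSpace (𝓡 3) (φ p))
    (V : ∀ x : M, TangentSpace (𝓡 3) x) (θ : ℝ) : Prop where
  mem_Icc : θ ∈ Set.Icc 0 Real.pi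
  inner_eq : ∀ p, inner ℝ (U p) (V (φ p)) = Real.cos θ
  tangential_ne_zero : ∀ p, V (φ p) - inner ℝ (V (φ p)) (U p) • U p ≠ 0

/-- The metric induced on `N` by `φ`. -/
def inducedMetric (φ : N → M) (p : N) (v w : TangentSpace (𝓡 2) p) : ℝ :=
  inner ℝ (mfderiv (𝓡 2) (𝓡 3) φ p v) (mfderiv (𝓡 2) (𝓡 3) φ p w)

/-- `κ` is the principal curvature of the surface along `v ∈ T_pN`: `v` is a nonzero vector
with `A v = κ v`, where the shape operator `A` is given by `dφ (A v) = -∇⁰_v U`. -/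
def IsPrincipalCurvatureAlong (φ : N → M) (U : ∀ p, TangentSpace (𝓡 3) (φ p)) (p : N)
    (v : TangentSpace (𝓡 2) p) (κ : ℝ) : Prop :=
  v ≠ 0 ∧ -covDerivAlong φ U p v = κ • mfderiv (𝓡 2) (𝓡 3) φ p v

/-- The `i`-th coordinate vector field of the local coordinate system `e` on `N`, at the point
with coordinates `y`. -/
def coordVector (e : OpenPartialHomeomorph N (EuclideanSpace ℝ (Fin 2))) (i : Fin 2)
    (y : EuclideanSpace ℝ (Fin 2)) : TangentSpace (𝓡 2) (e.symm y) :=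
  mfderiv (𝓡 2) (𝓡 2) e.symm y (EuclideanSpace.single i (1 : ℝ))

/-- The surface is ruled near `p`: a neighbourhood of `p` in `N` is foliated by curves that `φ`
maps to geodesics of `M`. In the smooth coordinates `e = (s, t)` the curves are the lines
`t = const`. -/
def IsRuledNear (φ : N → M) (p : N) : Prop :=
  ∃ e ∈ IsManifold.maximalAtlas (𝓡 2) ∞ N, p ∈ e.source ∧
    ∀ y ∈ e.target, IsGeodesicOn (E := EuclideanSpace ℝ (Fin 3))
      (fun τ ↦ φ (e.symm (y + τ • EuclideanSpace.single 0 (1 : ℝ))))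
      {τ | y + τ • EuclideanSpace.single 0 (1 : ℝ) ∈ e.target}

/-- Near `p` there are smooth coordinates `e = (s, t)` on `N` in which the induced metric is
`ds² + lam² dt²` with a smooth positive function `lam`, the direction `∂_t` is principal, with
principal curvature `κ₂`, and `(log lam)_s = (cos θ κ₂ + f) / sin θ`. -/
def HasAdaptedCoordinatesNear (φ : N → M) (U : ∀ p, TangentSpace (𝓡 3) (φ p)) (f : M → ℝ)
    (θ : ℝ) (p : N) : Prop :=
  ∃ e ∈ IsManifold.maximalAtlas (𝓡 2) ∞ N, p ∈ e.source ∧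
    ∃ lam κ₂ : EuclideanSpace ℝ (Fin 2) → ℝ, ContDiffOn ℝ ∞ lam e.target ∧
      ∀ y ∈ e.target, 0 < lam y ∧
        inducedMetric φ (e.symm y) (coordVector e 0 y) (coordVector e 0 y) = 1 ∧
        inducedMetric φ (e.symm y) (coordVector e 0 y) (coordVector e 1 y) = 0 ∧
        inducedMetric φ (e.symm y) (coordVector e 1 y) (coordVector e 1 y) = lam y ^ 2 ∧
        IsPrincipalCurvatureAlong φ U (e.symm y) (coordVector e 1 y) (κ₂ y) ∧
        HasLineDerivAt ℝ (fun z ↦ Real.log (lam z))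
          ((Real.cos θ * κ₂ y + f (φ (e.symm y))) / Real.sin θ) y
          (EuclideanSpace.single 0 (1 : ℝ))

end Surface

end ConstantAngle

end

/-! Write `c = cos θ`, `s = sin θ`. The axis splits along the surface as `V = s T + c U`, where `T`
is the unit vector in the direction of the tangential part, and differentiating this along a tangent
vector `X` gives `s ∇_X T + c ∇_X U = f (X - ⟨X, V⟩ V)`. Everything follows from the components of
this identity.

If `c = 0`, then `T` is a constant multiple of `V`. Since `V` is a unit field, `∇_V V = f (V - V) =
0`, so the integral curves of `T` are geodesics (`isGeodesicOn_coordLine`).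

In both cases coordinates are chosen with `X₀ = ∂_s = T` and with `X₁ = ∂_t` orthogonal to `X₀` on
the line where the first coordinate is zero (`exists_adapted_chart`). Put `F = ⟨X₀, X₁⟩` and `G =
⟨X₁, X₁⟩`. The normal component of the identity gives `⟨∇₁U, X₀⟩ = f c F`. By symmetry of the second
fundamental form this is also `⟨∇₀U, X₁⟩`, and the `X₁` component then reduces to `s ⟨∇₀X₀, X₁⟩ = f
F (1 - s² - c²) = 0`. Hence `∂_s F = 0` and `F` vanishes identically. Now `∇₁U` is orthogonal to
both `U` and `X₀`, so `X₁` is principal, with curvature `κ₂ = -⟨∇₁U, X₁⟩ / G`. The `X₁` component of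
the identity for `X = X₁` gives `s ⟨∇₁X₀, X₁⟩ = (c κ₂ + f) G`. Since `∂_s G = 2 ⟨∇₁X₀, X₁⟩`, this is
the equation for `λ = √G`. The pointwise algebra is collected in `FrameRelations`, and
`frameRelations` verifies it.

The coordinates come from a flow box (`exists_flowBox`), which needs flows that are smooth in time
and initial point jointly. These are obtained from the inverse function theorem in the Banach space
of continuous paths (`exists_contDiffOn_local_flow`). -/

noncomputable section

namespace ConstantAngle

open Set Filter Topology Metric

/-! ### Smoothness of superposition operators on spaces of continuous maps. -/

section Superposition

universe u

variable {K : Type*} [TopologicalSpace K] [CompactSpace K]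

/-- The bilinear map on continuous maps induced pointwise by a bilinear map. -/
def pointwiseBilinear (K : Type*) [TopologicalSpace K] [CompactSpace K] {G E F : Type*}
    [NormedAddCommGroup G] [NormedSpace ℝ G] [NormedAddCommGroup E] [NormedSpace ℝ E]
    [NormedAddCommGroup F] [NormedSpace ℝ F] (b : G →L[ℝ] E →L[ℝ] F) :
    C(K, G) →L[ℝ] C(K, E) →L[ℝ] C(K, F) :=
  LinearMap.mkContinuous₂
    (LinearMap.mk₂ ℝ (fun (A : C(K, G)) (h : C(K, E)) ↦
        (⟨fun k ↦ b (A k) (h k), by fun_prop⟩ : C(K, F)))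
      (fun _ _ _ ↦ by ext; simp) (fun _ _ _ ↦ by ext; simp)
      (fun _ _ _ ↦ by ext; simp) (fun _ _ _ ↦ by ext; simp)) ‖b‖
    (fun A h ↦ by
      rw [ContinuousMap.norm_le _ (by positivity)]
      intro k
      refine (b.le_opNorm₂ _ _).trans ?_
      have h1 := A.norm_coe_le_norm k
      have h2 := h.norm_coe_le_norm k
      gcongr)

@[simp]
theorem pointwiseBilinear_apply {G E F : Type*} [NormedAddCommGroup G] [NormedSpace ℝ G]
    [NormedAddCommGroup E] [NormedSpace ℝ E] [NormedAddCommGroup F] [NormedSpace ℝ F]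
    (b : G →L[ℝ] E →L[ℝ] F) (A : C(K, G)) (h : C(K, E)) (k : K) :
    pointwiseBilinear K b A h k = b (A k) (h k) := rfl

/-- The superposition operator `γ ↦ v ∘ γ` on continuous maps. -/
def superposition (K : Type*) [TopologicalSpace K] {E F : Type*} [TopologicalSpace E]
    [TopologicalSpace F] (v : E → F) (hv : Continuous v) (γ : C(K, E)) : C(K, F) :=
  ContinuousMap.comp ⟨v, hv⟩ γ

@[simp]
theorem superposition_apply {K E F : Type*} [TopologicalSpace K] [TopologicalSpace E]
    [TopologicalSpace F] (v : E → F) (hv : Continuous v) (γ : C(K, E)) (k : K) :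
    superposition K v hv γ k = v (γ k) := rfl

/-- The range of `γ` is compact, so `v'` is uniformly continuous near it and a single `δ` serves in
the mean value estimate at every `k`. This is what makes the remainder small in the sup norm. -/
theorem hasFDerivAt_superposition {E F : Type*} [NormedAddCommGroup E] [NormedSpace ℝ E]
    [NormedAddCommGroup F] [NormedSpace ℝ F] {v : E → F} {v' : E → E →L[ℝ] F}
    (hv : Continuous v) (hv' : Continuous v') (h : ∀ x, HasFDerivAt v (v' x) x) (γ : C(K, E)) :
    HasFDerivAt (superposition K v hv)
      (pointwiseBilinear K (ContinuousLinearMap.id ℝ (E →L[ℝ] F)) (superposition K v' hv' γ)) γ := by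
  rw [hasFDerivAt_iff_isLittleO_nhds_zero, Asymptotics.isLittleO_iff]
  intro ε hε
  have hcpt : IsCompact (range γ) := isCompact_range γ.continuous
  have hunif := hcpt.uniformContinuousAt_of_continuousAt v' (fun a _ ↦ hv'.continuousAt)
    (Metric.dist_mem_uniformity hε)
  obtain ⟨δ, hδ, hδ'⟩ := Metric.mem_uniformity_dist.1 hunif
  filter_upwards [ball_mem_nhds (0 : C(K, E)) hδ] with η hη
  rw [ContinuousMap.norm_le _ (by positivity)]
  intro k
  have hk : ‖η k‖ < δ := (η.norm_coe_le_norm k).trans_lt (by simpa using hη)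
  have hder := Convex.norm_image_sub_le_of_norm_hasFDerivWithin_le' (𝕜 := ℝ) (f := v) (f' := v')
    (φ := v' (γ k)) (C := ε) (s := ball (γ k) δ) (x := γ k) (y := γ k + η k)
    (fun x _ ↦ (h x).hasFDerivWithinAt)
    (fun x hx ↦ by
      have := hδ' (a := γ k) (b := x) (by rw [dist_comm]; exact hx) (mem_range_self k)
      rw [← dist_eq_norm, dist_comm]
      exact le_of_lt this)
    (convex_ball _ _) (mem_ball_self hδ) (by simpa using hk)
  have e : (superposition K v hv (γ + η) - superposition K v hv γ -
      pointwiseBilinear K (ContinuousLinearMap.id ℝ (E →L[ℝ] F)) (superposition K v' hv' γ) η) k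
      = v (γ k + η k) - v (γ k) - v' (γ k) (γ k + η k - γ k) := by simp
  rw [e]
  refine hder.trans ?_
  rw [add_sub_cancel_left]
  exact mul_le_mul_of_nonneg_left (η.norm_coe_le_norm k) hε.le

-- The derivative of a superposition operator is built from the superposition operator of `v'`,
-- which is one order less smooth, so induction on the order applies. The target changes from `F` to
-- `E →L[ℝ] F` at each step; keeping `E` and `F` in one universe lets the induction hypothesis cover
-- it.
set_option synthInstance.maxHeartbeats 200000 in
theorem contDiff_superposition_nat (n : ℕ) : ∀ {E F : Type u} [NormedAddCommGroup E]
    [NormedSpace ℝ E] [NormedAddCommGroup F] [NormedSpace ℝ F] {v : E → F} (hv : ContDiff ℝ n v),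
    ContDiff ℝ n (superposition K v hv.continuous) := by
  induction n with
  | zero =>
    intro E F _ _ _ _ v hv
    exact contDiff_zero.2 (ContinuousMap.continuous_postcomp _)
  | succ n ih =>
    intro E F _ _ _ _ v hv
    obtain ⟨v', hv', h⟩ := contDiff_succ_iff_hasFDerivAt.1 (by exact_mod_cast hv)
    have := contDiff_succ_iff_hasFDerivAt (𝕜 := ℝ) (n := n)
      (f := superposition K v hv.continuous)
    push_cast
    exact this.2 ⟨fun γ ↦ pointwiseBilinear K (ContinuousLinearMap.id ℝ (E →L[ℝ] F))
      (superposition K v' hv'.continuous γ),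
      (pointwiseBilinear K (ContinuousLinearMap.id ℝ (E →L[ℝ] F))).contDiff.comp (ih hv'),
      hasFDerivAt_superposition hv.continuous hv'.continuous h⟩

theorem contDiff_superposition {E F : Type u} [NormedAddCommGroup E]
    [NormedSpace ℝ E] [NormedAddCommGroup F] [NormedSpace ℝ F] {v : E → F} (hv : ContDiff ℝ ∞ v) :
    ContDiff ℝ ∞ (superposition K v hv.continuous) :=
  contDiff_infty.2 fun n ↦ contDiff_superposition_nat n (contDiff_infty.1 hv n)

end Superposition

/-! ### The inverse function theorem with an inverse smooth on its whole domain. -/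

section LocalInverse

/-- Smooth inverse function theorem on an open set. -/
theorem exists_openPartialHomeomorph_of_contDiffOn {E F : Type*} [NormedAddCommGroup E]
    [NormedSpace ℝ E] [CompleteSpace E] [NormedAddCommGroup F] [NormedSpace ℝ F] {f : E → F}
    {s : Set E} (hs : IsOpen s) (hf : ContDiffOn ℝ ∞ f s) {a : E} (ha : a ∈ s) {f' : E ≃L[ℝ] F}
    (hf' : HasFDerivAt f (f' : E →L[ℝ] F) a) :
    ∃ Φ : OpenPartialHomeomorph E F, ⇑Φ = f ∧ a ∈ Φ.source ∧ Φ.source ⊆ s ∧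
      ContDiffOn ℝ ∞ Φ.symm Φ.target := by
  have hfa : ContDiffAt ℝ ∞ f a := hf.contDiffAt (hs.mem_nhds ha)
  let Φ₀ := hfa.toOpenPartialHomeomorph f hf' (by simp)
  have hcoe : ⇑Φ₀ = f := hfa.toOpenPartialHomeomorph_coe hf' (by simp)
  have hcont : ContinuousAt (fderiv ℝ f) a := (hfa.fderiv_right (m := 0) (by simp)).continuousAt
  -- Invertibility of the derivative is an open condition. After shrinking the source it holds at
  -- every point, so the inverse is smooth on the whole target and not only at `f a`.
  have hnhds : fderiv ℝ f ⁻¹' range ((↑) : (E ≃L[ℝ] F) → (E →L[ℝ] F)) ∈ 𝓝 a := by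
    apply hcont
    rw [hf'.fderiv]
    exact f'.nhds
  obtain ⟨u, hu, huo, hau⟩ := _root_.mem_nhds_iff.1 (inter_mem hnhds (hs.mem_nhds ha))
  refine ⟨Φ₀.restrOpen u huo, ?_, ?_, ?_, ?_⟩
  · simpa using hcoe
  · exact ⟨hfa.mem_toOpenPartialHomeomorph_source hf' (by simp), hau⟩
  · intro x hx
    exact (hu hx.2).2
  · intro y hy
    have hx := (Φ₀.restrOpen u huo).map_target hy
    obtain ⟨⟨A, hA⟩, hxs⟩ := hu hx.2
    have hd : ContDiffAt ℝ ∞ f ((Φ₀.restrOpen u huo).symm y) := hf.contDiffAt (hs.mem_nhds hxs)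
    refine ((Φ₀.restrOpen u huo).contDiffAt_symm (f₀' := A) hy ?_ ?_).contDiffWithinAt
    · have : ⇑(Φ₀.restrOpen u huo) = f := by simpa using hcoe
      rw [this, hA]
      exact (hd.differentiableAt (by simp)).hasFDerivAt
    · have : ⇑(Φ₀.restrOpen u huo) = f := by simpa using hcoe
      rw [this]
      exact hd

end LocalInverse

/-! ### The initial value problem as an equation between continuous paths. -/

section Flow

variable {E : Type*} [NormedAddCommGroup E] [NormedSpace ℝ E] [CompleteSpace E]

/-- The primitive `τ ↦ ∫₀^τ γ` on the unit interval. -/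
def primitive (E : Type*) [NormedAddCommGroup E] [NormedSpace ℝ E] [CompleteSpace E] :
    C(unitInterval, E) →L[ℝ] C(unitInterval, E) :=
  LinearMap.mkContinuous
    { toFun := fun γ ↦ ⟨fun τ ↦ ∫ x in (0 : ℝ)..τ, IccExtend zero_le_one γ x, by
        have h : Continuous (IccExtend zero_le_one γ) := γ.continuous.Icc_extend'
        exact (intervalIntegral.continuous_primitive
          (fun a b ↦ h.intervalIntegrable a b) 0).comp continuous_subtype_val⟩
      map_add' := fun γ η ↦ by
        ext τ
        have h : Continuous (IccExtend zero_le_one γ) := γ.continuous.Icc_extend'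
        have h' : Continuous (IccExtend zero_le_one η) := η.continuous.Icc_extend'
        exact intervalIntegral.integral_add (h.intervalIntegrable _ _) (h'.intervalIntegrable _ _)
      map_smul' := fun c γ ↦ by
        ext τ
        exact intervalIntegral.integral_smul c _ } 1
    (fun γ ↦ by
      rw [ContinuousMap.norm_le _ (by positivity)]
      intro τ
      have := intervalIntegral.norm_integral_le_of_norm_le_const (a := 0) (b := (τ : ℝ))
        (f := IccExtend zero_le_one γ) (C := ‖γ‖) (fun x _ ↦ γ.norm_coe_le_norm _)
      refine this.trans ?_
      rw [one_mul]
      refine mul_le_of_le_one_right (norm_nonneg _) ?_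
      rw [sub_zero, abs_of_nonneg τ.2.1]
      exact τ.2.2)

/-- Constant maps, as a continuous linear map. -/
def constCLM (E : Type*) [NormedAddCommGroup E] [NormedSpace ℝ E] :
    E →L[ℝ] C(unitInterval, E) :=
  LinearMap.mkContinuous
    { toFun := ContinuousMap.const unitInterval
      map_add' := fun _ _ ↦ rfl
      map_smul' := fun _ _ ↦ rfl } 1
    (fun x ↦ by
      rw [ContinuousMap.norm_le _ (by positivity)]
      intro τ
      rw [one_mul]
      exact le_refl ‖x‖)

@[simp]
theorem constCLM_apply {E : Type*} [NormedAddCommGroup E] [NormedSpace ℝ E] (x : E)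
    (τ : unitInterval) : constCLM E x τ = x := rfl

/-- The map whose zero fibre consists of the solutions on the unit interval of `γ' = ε v(γ)`,
`γ 0 = x`. -/
def integralEquationMap (v : E → E) (hv : Continuous v) (q : C(unitInterval, E) × E × ℝ) :
    C(unitInterval, E) × E × ℝ :=
  (q.1 - constCLM E q.2.1 - q.2.2 • primitive E (superposition unitInterval v hv q.1), q.2)

theorem contDiff_integralEquationMap {v : E → E} (hv : ContDiff ℝ ∞ v) :
    ContDiff ℝ ∞ (integralEquationMap v hv.continuous) := by
  have h1 : ContDiff ℝ ∞ fun q : C(unitInterval, E) × E × ℝ ↦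
      superposition unitInterval v hv.continuous q.1 :=
    (contDiff_superposition hv).comp contDiff_fst
  have h2 := (primitive E).contDiff.comp h1
  have h3 : ContDiff ℝ ∞ fun q : C(unitInterval, E) × E × ℝ ↦ constCLM E q.2.1 :=
    (constCLM E).contDiff.comp (contDiff_fst.comp contDiff_snd)
  exact ((contDiff_fst.sub h3).sub ((contDiff_snd.comp contDiff_snd).smul h2)).prodMk contDiff_snd

/-- The shear `(h, k, e) ↦ (h - k - e c, k, e)`. -/
def shearEquiv (c : C(unitInterval, E)) :
    (C(unitInterval, E) × E × ℝ) ≃L[ℝ] (C(unitInterval, E) × E × ℝ) :=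
  let P : (C(unitInterval, E) × E × ℝ) →L[ℝ] C(unitInterval, E) :=
    (constCLM E).comp ((ContinuousLinearMap.fst ℝ E ℝ).comp (ContinuousLinearMap.snd ℝ _ _)) +
      ((ContinuousLinearMap.snd ℝ E ℝ).comp (ContinuousLinearMap.snd ℝ _ _)).smulRight c
  ContinuousLinearEquiv.equivOfInverse
    ((ContinuousLinearMap.fst ℝ _ _ - P).prod (ContinuousLinearMap.snd ℝ _ _))
    ((ContinuousLinearMap.fst ℝ _ _ + P).prod (ContinuousLinearMap.snd ℝ _ _))
    (fun q ↦ by ext <;> simp [P])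
    (fun q ↦ by ext <;> simp [P])

/-- The base point has time scale `0`, so in the product rule the derivative of the nonlinear
integral is multiplied by `0`. Only its value `∫ v(x₀)` survives, as the coefficient of the time
increment, and the result is an invertible shear. -/
theorem hasFDerivAt_integralEquationMap {v : E → E} (hv : ContDiff ℝ ∞ v) (x₀ : E) :
    HasFDerivAt (integralEquationMap v hv.continuous)
      (shearEquiv (primitive E (constCLM E (v x₀))) :
        (C(unitInterval, E) × E × ℝ) →L[ℝ] (C(unitInterval, E) × E × ℝ))
      (constCLM E x₀, x₀, 0) := by
  have h1 : ContDiff ℝ ∞ fun q : C(unitInterval, E) × E × ℝ ↦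
      primitive E (superposition unitInterval v hv.continuous q.1) :=
    (primitive E).contDiff.comp ((contDiff_superposition hv).comp contDiff_fst)
  have h2 := (h1.differentiable (by simp) (constCLM E x₀, x₀, 0)).hasFDerivAt
  have hε : HasFDerivAt (fun q : C(unitInterval, E) × E × ℝ ↦ q.2.2)
      ((ContinuousLinearMap.snd ℝ E ℝ).comp (ContinuousLinearMap.snd ℝ _ _))
      (constCLM E x₀, x₀, 0) :=
    ((ContinuousLinearMap.snd ℝ E ℝ).comp
      (ContinuousLinearMap.snd ℝ C(unitInterval, E) (E × ℝ))).hasFDerivAt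
  have hx : HasFDerivAt (fun q : C(unitInterval, E) × E × ℝ ↦ constCLM E q.2.1)
      ((constCLM E).comp ((ContinuousLinearMap.fst ℝ E ℝ).comp (ContinuousLinearMap.snd ℝ _ _)))
      (constCLM E x₀, x₀, 0) :=
    ((constCLM E).comp ((ContinuousLinearMap.fst ℝ E ℝ).comp
      (ContinuousLinearMap.snd ℝ C(unitInterval, E) (E × ℝ)))).hasFDerivAt
  have key := ((hasFDerivAt_fst.sub hx).sub (hε.smul h2)).prodMk hasFDerivAt_snd
  refine key.congr_fderiv ?_
  have hc : superposition unitInterval v hv.continuous (constCLM E x₀) = constCLM E (v x₀) := rfl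
  ext q <;> simp [shearEquiv, hc]

end Flow

/-! ### Existence of a flow smooth in time and initial point. -/

section FlowExistence

variable {E : Type*} [NormedAddCommGroup E] [NormedSpace ℝ E] [CompleteSpace E]

/-- Multiplication by `u` on the unit interval. -/
def scaleUnitInterval (u : unitInterval) : C(unitInterval, unitInterval) :=
  ⟨fun τ ↦ τ * u, by fun_prop⟩

theorem integralEquationMap_fst_apply (v : E → E) (hv : Continuous v) (γ : C(unitInterval, E))
    (x : E) (s : ℝ) (τ : unitInterval) :
    (integralEquationMap v hv (γ, x, s)).1 τ =
      γ τ - x - s • ∫ w in (0 : ℝ)..τ, v (IccExtend zero_le_one γ w) := rfl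

theorem IccExtend_comp_scale {X : Type*} [TopologicalSpace X] (γ : C(unitInterval, X))
    (u : unitInterval) {w : ℝ}
    (hw : w ∈ unitInterval) :
    IccExtend (zero_le_one' ℝ) (γ.comp (scaleUnitInterval u)) w
      = IccExtend (zero_le_one' ℝ) γ (w * u) := by
  have hwu : w * (u : ℝ) ∈ unitInterval :=
    ⟨mul_nonneg hw.1 u.2.1, mul_le_one₀ hw.2 u.2.1 u.2.2⟩
  rw [IccExtend_of_mem _ _ hw, IccExtend_of_mem _ _ hwu]
  rfl

/-- Rescaling time in a solution of the integral equation gives another solution. -/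
theorem integralEquationMap_scale (v : E → E) (hv : Continuous v) {γ : C(unitInterval, E)}
    {x : E} {s : ℝ} (h : (integralEquationMap v hv (γ, x, s)).1 = 0) (u : unitInterval) :
    (integralEquationMap v hv (γ.comp (scaleUnitInterval u), x, u * s)).1 = 0 := by
  ext τ
  have hτ := DFunLike.congr_fun h (τ * u)
  rw [integralEquationMap_fst_apply] at hτ ⊢
  have h1 : ∫ w in (0 : ℝ)..τ, v (IccExtend (zero_le_one' ℝ) (γ.comp (scaleUnitInterval u)) w)
      = ∫ w in (0 : ℝ)..τ, v (IccExtend (zero_le_one' ℝ) γ (w * u)) := by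
    apply intervalIntegral.integral_congr
    intro w hw
    rw [uIcc_of_le τ.2.1] at hw
    exact congrArg v (IccExtend_comp_scale γ u ⟨hw.1, hw.2.trans τ.2.2⟩)
  -- The factor `u` of the new time scale is absorbed by the substitution `w ↦ w * u`, which turns
  -- the claim into the old equation at time `τ * u`.
  rw [h1, mul_comm, mul_smul,
    intervalIntegral.smul_integral_comp_mul_right (fun w ↦ v (IccExtend (zero_le_one' ℝ) γ w)),
    zero_mul]
  exact hτ

/-- A smooth vector field has a local flow that depends smoothly on time and the initial point. -/
theorem exists_contDiffOn_local_flow {v : E → E} (hv : ContDiff ℝ ∞ v) (x₀ : E) :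
    ∃ r > 0, ∃ φ : ℝ × E → E, ContDiffOn ℝ ∞ φ (ball 0 r ×ˢ ball x₀ r) ∧
      ∀ x ∈ ball x₀ r, φ (0, x) = x ∧
        ∀ s ∈ ball (0 : ℝ) r, HasDerivAt (fun σ ↦ φ (σ, x)) (v (φ (s, x))) s := by
  set a : C(unitInterval, E) × E × ℝ := (constCLM E x₀, x₀, 0) with ha_def
  obtain ⟨Φ, hΦ, ha, -, hsm⟩ := exists_openPartialHomeomorph_of_contDiffOn isOpen_univ
    (contDiff_integralEquationMap hv).contDiffOn (mem_univ a)
    (hasFDerivAt_integralEquationMap hv x₀)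
  obtain ⟨ρ, hρ, hρs⟩ := Metric.mem_nhds_iff.1 (Φ.open_source.mem_nhds ha)
  -- Solutions are the points with vanishing first component, so `Φ.symm (0, x, s)` is the path
  -- solving `γ' = s v(γ)`, `γ 0 = x` on the unit interval.
  let ι : ℝ × E → C(unitInterval, E) × E × ℝ := fun q ↦ (0, q.2, q.1)
  have hι : ContDiff ℝ ∞ ι := contDiff_const.prodMk (contDiff_snd.prodMk contDiff_fst)
  have hιa : ι (0, x₀) = Φ a := by
    rw [hΦ]
    refine Prod.ext ?_ rfl
    ext τ
    rw [integralEquationMap_fst_apply]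
    simp [ι]
  have htarget : ι (0, x₀) ∈ Φ.target := hιa ▸ Φ.map_source ha
  -- The solutions are kept in a ball around the constant path that lies inside `Φ.source`, so that
  -- rescaled solutions can be shown to stay in the source too.
  have hO : ∀ᶠ q in 𝓝 ((0 : ℝ), x₀), ι q ∈ Φ.target ∧ Φ.symm (ι q) ∈ ball a ρ := by
    have h1 : ∀ᶠ q in 𝓝 ((0 : ℝ), x₀), ι q ∈ Φ.target :=
      hι.continuous.continuousAt (Φ.open_target.mem_nhds htarget)
    refine h1.and ?_
    have h2 : ContinuousAt (fun q ↦ Φ.symm (ι q)) ((0 : ℝ), x₀) :=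
      ContinuousAt.comp (f := ι) (Φ.continuousAt_symm htarget) hι.continuous.continuousAt
    refine h2 ?_
    simp only [hιa, Φ.left_inv ha]
    exact ball_mem_nhds a hρ
  obtain ⟨r, hr, hrO⟩ := Metric.eventually_nhds_iff_ball.1 hO
  rw [← ball_prod_same] at hrO
  let γ : ℝ × E → C(unitInterval, E) := fun q ↦ (Φ.symm (ι q)).1
  have hΦγ : ∀ q ∈ ball (0 : ℝ) r ×ˢ ball x₀ r, Φ.symm (ι q) = (γ q, q.2, q.1) ∧
      (integralEquationMap v hv.continuous (γ q, q.2, q.1)).1 = 0 := by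
    intro q hq
    have h := Φ.right_inv (hrO q hq).1
    rw [hΦ] at h
    have h2 : (Φ.symm (ι q)).2 = (q.2, q.1) := congrArg Prod.snd h
    have h3 : Φ.symm (ι q) = (γ q, q.2, q.1) := Prod.ext rfl h2
    refine ⟨h3, ?_⟩
    rw [← h3]
    exact congrArg Prod.fst h
  have hball : ∀ s ∈ ball (0 : ℝ) r, ∀ u : unitInterval, (u : ℝ) * s ∈ ball (0 : ℝ) r := by
    intro s hs u
    rw [mem_ball_zero_iff, norm_mul, Real.norm_of_nonneg u.2.1] at *
    exact (mul_le_of_le_one_left (norm_nonneg s) u.2.2).trans_lt hs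
  -- Uniqueness comes from injectivity of `Φ`: reparametrizing a path does not increase its sup
  -- distance to a constant, so the rescaled solution is again in the source and has the same image
  -- as the solution for time scale `u * s`.
  have hscale : ∀ s ∈ ball (0 : ℝ) r, ∀ x ∈ ball x₀ r, ∀ u : unitInterval,
      γ (u * s, x) = (γ (s, x)).comp (scaleUnitInterval u) := by
    intro s hs x hx u
    obtain ⟨h1, h2⟩ := hΦγ (s, x) ⟨hs, hx⟩
    obtain ⟨h3, -⟩ := hΦγ (u * s, x) ⟨hball s hs u, hx⟩
    have hmem := (hrO (s, x) ⟨hs, hx⟩).2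
    rw [h1, ha_def, ← ball_prod_same, ← ball_prod_same] at hmem
    have hmem' := (hrO (u * s, x) ⟨hball s hs u, hx⟩).2
    rw [h3, ha_def, ← ball_prod_same, ← ball_prod_same] at hmem'
    have hsrc : ((γ (s, x)).comp (scaleUnitInterval u), x, (u : ℝ) * s) ∈ Φ.source := by
      apply hρs
      rw [ha_def, ← ball_prod_same, ← ball_prod_same]
      refine ⟨?_, hmem'.2⟩
      rw [mem_ball, ContinuousMap.dist_lt_iff hρ]
      intro τ
      exact (ContinuousMap.dist_apply_le_dist (f := γ (s, x)) (g := constCLM E x₀)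
        (scaleUnitInterval u τ)).trans_lt hmem.1
    have hval : Φ ((γ (s, x)).comp (scaleUnitInterval u), x, (u : ℝ) * s) = ι (u * s, x) := by
      rw [hΦ]
      exact Prod.ext (integralEquationMap_scale v hv.continuous h2 u) rfl
    have := Φ.left_inv hsrc
    rw [hval] at this
    exact congrArg Prod.fst this
  -- At parameter `1` the path with time scale `s` has followed `v` for time `s`.
  let φ : ℝ × E → E := fun q ↦ γ q 1
  have hφ : ContDiffOn ℝ ∞ φ (ball 0 r ×ˢ ball x₀ r) := by
    have h1 : ContDiffOn ℝ ∞ (fun q ↦ Φ.symm (ι q)) (ball 0 r ×ˢ ball x₀ r) :=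
      hsm.comp hι.contDiffOn fun q hq ↦ (hrO q hq).1
    exact ((ContinuousMap.evalCLM (M := E) ℝ (1 : unitInterval)).contDiff.comp
      contDiff_fst).comp_contDiffOn h1
  -- By rescaling, the path for `s` at parameter `w` is `φ (w * s, x)`. The equation for paths
  -- becomes an integral equation in the time variable, to which the fundamental theorem of calculus
  -- applies.
  have hint : ∀ s ∈ ball (0 : ℝ) r, ∀ x ∈ ball x₀ r,
      φ (s, x) = x + ∫ w in (0 : ℝ)..s, v (φ (w, x)) := by
    intro s hs x hx
    obtain ⟨-, h2⟩ := hΦγ (s, x) ⟨hs, hx⟩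
    have h3 := DFunLike.congr_fun h2 1
    rw [integralEquationMap_fst_apply] at h3
    have h4 : ∫ w in (0 : ℝ)..((1 : unitInterval) : ℝ), v (IccExtend (zero_le_one' ℝ) (γ (s, x)) w)
        = ∫ w in (0 : ℝ)..1, v (φ (w * s, x)) := by
      apply intervalIntegral.integral_congr
      intro w hw
      rw [uIcc_of_le (by simp)] at hw
      have hw' : w ∈ unitInterval := by simpa using hw
      have := DFunLike.congr_fun (hscale s hs x hx ⟨w, hw'⟩) 1
      change v _ = v (γ (w * s, x) 1)
      have hone : scaleUnitInterval ⟨w, hw'⟩ 1 = ⟨w, hw'⟩ := Subtype.ext (one_mul w)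
      rw [IccExtend_of_mem _ _ hw', this, ContinuousMap.comp_apply, hone]
    rw [h4, intervalIntegral.smul_integral_comp_mul_right (fun w ↦ v (φ (w, x))), zero_mul,
      one_mul, sub_sub, ContinuousMap.zero_apply, sub_eq_zero] at h3
    exact h3
  refine ⟨r, hr, φ, hφ, fun x hx ↦ ⟨?_, fun s hs ↦ ?_⟩⟩
  · rw [hint 0 (mem_ball_self hr) x hx]
    simp
  · have hcont : ContinuousOn (fun w ↦ v (φ (w, x))) (ball (0 : ℝ) r) :=
      hv.continuous.comp_continuousOn (hφ.continuousOn.comp (by fun_prop) fun w hw ↦ ⟨hw, hx⟩)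
    have hsub : uIcc 0 s ⊆ ball (0 : ℝ) r :=
      (convex_ball (0 : ℝ) r).ordConnected.uIcc_subset (mem_ball_self hr) hs
    have hd := intervalIntegral.integral_hasDerivAt_right
      (hcont.mono hsub).intervalIntegrable
      (hcont.stronglyMeasurableAtFilter isOpen_ball s hs)
      (hcont.continuousAt (isOpen_ball.mem_nhds hs))
    refine (hd.const_add x).congr_of_eventuallyEq ?_
    filter_upwards [isOpen_ball.mem_nhds hs] with σ hσ
    exact hint σ hσ x hx

end FlowExistence

/-! ### Straightening a vector field of the plane. -/

section FlowBox

/-- A smooth map near a point agrees near that point with a globally smooth one. -/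
theorem exists_contDiff_eventuallyEq {E F : Type*} [NormedAddCommGroup E] [NormedSpace ℝ E]
    [FiniteDimensional ℝ E] [NormedAddCommGroup F] [NormedSpace ℝ F] {f : E → F} {s : Set E}
    (hs : IsOpen s) (hf : ContDiffOn ℝ ∞ f s) {a : E} (ha : a ∈ s) :
    ∃ g : E → F, ContDiff ℝ ∞ g ∧ g =ᶠ[𝓝 a] f := by
  obtain ⟨ε, hε, hεs⟩ := Metric.mem_nhds_iff.1 (hs.mem_nhds ha)
  -- The support of the bump is the closed ball of radius `ε / 2`, inside the ball of radius `ε`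
  -- contained in `s`; the product with `f` therefore extends smoothly by zero.
  let χ : ContDiffBump a := ⟨ε / 4, ε / 2, by positivity, by linarith⟩
  refine ⟨fun x ↦ χ x • f x, contDiff_iff_contDiffAt.2 fun x ↦ ?_, ?_⟩
  · by_cases hx : x ∈ s
    · exact χ.contDiff.contDiffAt.smul (hf.contDiffAt (hs.mem_nhds hx))
    · have h0 : (fun x ↦ χ x • f x) =ᶠ[𝓝 x] fun _ ↦ (0 : F) := by
        have hx' : x ∈ (tsupport χ)ᶜ := by
          rw [χ.tsupport_eq]
          intro h
          exact hx (hεs (closedBall_subset_ball (by change ε / 2 < ε; linarith) h))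
        filter_upwards [(isClosed_tsupport χ).isOpen_compl.mem_nhds hx'] with y hy
        rw [image_eq_zero_of_notMem_tsupport hy, zero_smul]
      exact contDiffAt_const.congr_of_eventuallyEq h0
  · filter_upwards [closedBall_mem_nhds a χ.rIn_pos] with x hx
    rw [χ.one_of_mem_closedBall hx, one_smul]

/-- The open coordinate square of half-side `r` in the plane. -/
def openSquare (r : ℝ) : Set (EuclideanSpace ℝ (Fin 2)) := {z | |z 0| < r ∧ |z 1| < r}

theorem isOpen_setOf_abs_lt (r r' : ℝ) :
    IsOpen {z : EuclideanSpace ℝ (Fin 2) | |z 0| < r ∧ |z 1| < r'} :=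
  (isOpen_lt (f := fun z : EuclideanSpace ℝ (Fin 2) ↦ |z 0|) (by fun_prop)
    continuous_const).inter
    (isOpen_lt (f := fun z : EuclideanSpace ℝ (Fin 2) ↦ |z 1|) (by fun_prop) continuous_const)

theorem isOpen_openSquare (r : ℝ) : IsOpen (openSquare r) := isOpen_setOf_abs_lt r r

theorem exists_openSquare_subset {s : Set (EuclideanSpace ℝ (Fin 2))}
    (hs : s ∈ 𝓝 (0 : EuclideanSpace ℝ (Fin 2))) : ∃ r > 0, openSquare r ⊆ s := by
  obtain ⟨ε, hε, hεs⟩ := Metric.mem_nhds_iff.1 hs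
  refine ⟨ε / 2, by positivity, fun z hz ↦ hεs ?_⟩
  rw [mem_ball_zero_iff, EuclideanSpace.norm_eq, Real.sqrt_lt' hε]
  simp only [Fin.sum_univ_two, Real.norm_eq_abs, sq_abs]
  have h0 := abs_lt.1 hz.1
  have h1 := abs_lt.1 hz.2
  nlinarith

/-- Straightening of a vector field `T` of the plane, starting from an integral curve of a
transversal vector field `W`. -/
theorem exists_flowBox {T W : EuclideanSpace ℝ (Fin 2) → EuclideanSpace ℝ (Fin 2)}
    {Ω : Set (EuclideanSpace ℝ (Fin 2))} (hΩ : IsOpen Ω) (hT : ContDiffOn ℝ ∞ T Ω)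
    (hW : ContDiffOn ℝ ∞ W Ω) {y₀ : EuclideanSpace ℝ (Fin 2)} (hy₀ : y₀ ∈ Ω)
    (hli : ∀ a b : ℝ, a • T y₀ + b • W y₀ = 0 → a = 0 ∧ b = 0) :
    ∃ r > 0, ∃ Ψ : OpenPartialHomeomorph (EuclideanSpace ℝ (Fin 2)) (EuclideanSpace ℝ (Fin 2)),
      Ψ.source = openSquare r ∧ Ψ 0 = y₀ ∧ Ψ.target ⊆ Ω ∧
      ContDiffOn ℝ ∞ Ψ Ψ.source ∧ ContDiffOn ℝ ∞ Ψ.symm Ψ.target ∧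
      (∀ z ∈ openSquare r, HasLineDerivAt ℝ Ψ (T (Ψ z)) z (EuclideanSpace.single 0 (1 : ℝ))) ∧
      ∀ z ∈ openSquare r, z 0 = 0 →
        HasLineDerivAt ℝ Ψ (W (Ψ z)) z (EuclideanSpace.single 1 (1 : ℝ)) := by
  -- The flow theorem needs globally smooth fields. The modified fields agree with `T` and `W` near
  -- `y₀`, and the square is finally shrunk to where they agree.
  obtain ⟨T', hT', hTT'⟩ := exists_contDiff_eventuallyEq hΩ hT hy₀
  obtain ⟨W', hW', hWW'⟩ := exists_contDiff_eventuallyEq hΩ hW hy₀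
  obtain ⟨rT, hrT, φ, hφ, hφd⟩ := exists_contDiffOn_local_flow hT' y₀
  obtain ⟨rW, hrW, χ, hχ, hχd⟩ := exists_contDiffOn_local_flow hW' y₀
  let c : ℝ → EuclideanSpace ℝ (Fin 2) := fun t ↦ χ (t, y₀)
  have hc : ContDiffOn ℝ ∞ c (ball 0 rW) :=
    hχ.comp (contDiff_id.prodMk contDiff_const).contDiffOn fun t ht ↦ ⟨ht, mem_ball_self hrW⟩
  have hc0 : c 0 = y₀ := (hχd y₀ (mem_ball_self hrW)).1
  have hcd : ∀ t ∈ ball (0 : ℝ) rW, HasDerivAt c (W' (c t)) t := (hχd y₀ (mem_ball_self hrW)).2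
  obtain ⟨r₁, hr₁, hr₁c⟩ := Metric.eventually_nhds_iff_ball.1
    (((hcd 0 (mem_ball_self hrW)).continuousAt.eventually
      (by rw [hc0]; exact ball_mem_nhds y₀ hrT)).and (ball_mem_nhds 0 hrW))
  let D : Set (EuclideanSpace ℝ (Fin 2)) := {z | |z 0| < rT ∧ |z 1| < r₁}
  have hD : IsOpen D := isOpen_setOf_abs_lt rT r₁
  have hD1 : ∀ z ∈ D, z 0 ∈ ball (0 : ℝ) rT ∧ c (z 1) ∈ ball y₀ rT ∧ z 1 ∈ ball (0 : ℝ) rW := by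
    intro z hz
    have h := hr₁c (z 1) (by simpa using hz.2)
    exact ⟨by simpa using hz.1, h.1, h.2⟩
  -- From the point `c t` of an integral curve of `W`, follow the flow of `T` for time `s`. The
  -- first coordinate lines are then integral curves of `T`, while `∂_t` equals `W` only where `s =
  -- 0`.
  let ψ : EuclideanSpace ℝ (Fin 2) → EuclideanSpace ℝ (Fin 2) := fun z ↦ φ (z 0, c (z 1))
  have hψ : ContDiffOn ℝ ∞ ψ D := by
    refine hφ.comp (ContDiffOn.prodMk ?_ ?_) fun z hz ↦ ⟨(hD1 z hz).1, (hD1 z hz).2.1⟩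
    · exact (by fun_prop : ContDiff ℝ ∞ fun z : EuclideanSpace ℝ (Fin 2) ↦ z 0).contDiffOn
    · exact hc.comp (by fun_prop : ContDiff ℝ ∞ fun z : EuclideanSpace ℝ (Fin 2) ↦ z 1).contDiffOn
        fun z hz ↦ (hD1 z hz).2.2
  have hψT : ∀ z ∈ D, HasLineDerivAt ℝ ψ (T' (ψ z)) z (EuclideanSpace.single 0 (1 : ℝ)) := by
    intro z hz
    have h1 := (hφd (c (z 1)) (hD1 z hz).2.1).2 (z 0) (hD1 z hz).1
    have h2 : HasDerivAt (fun t : ℝ ↦ z 0 + t) 1 0 := (hasDerivAt_id 0).const_add _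
    have h3 := HasDerivAt.scomp_of_eq (x := (0 : ℝ)) (h := fun t : ℝ ↦ z 0 + t) h1 h2 (by simp)
    rw [one_smul] at h3
    unfold HasLineDerivAt
    convert h3 using 1
    ext t : 1
    simp [ψ]
  have hψW : ∀ z ∈ D, z 0 = 0 →
      HasLineDerivAt ℝ ψ (W' (ψ z)) z (EuclideanSpace.single 1 (1 : ℝ)) := by
    intro z hz hz0
    have hψc : ψ z = c (z 1) := by
      simp only [ψ, hz0]
      exact (hφd (c (z 1)) (hD1 z hz).2.1).1
    have h1 := hcd (z 1) (hD1 z hz).2.2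
    have h2 : HasDerivAt (fun t : ℝ ↦ z 1 + t) 1 0 := (hasDerivAt_id 0).const_add _
    have h3 := HasDerivAt.scomp_of_eq (x := (0 : ℝ)) (h := fun t : ℝ ↦ z 1 + t) h1 h2 (by simp)
    rw [one_smul, ← hψc] at h3
    refine HasDerivAt.congr_of_eventuallyEq h3 ?_
    have hcont : Continuous fun t : ℝ ↦ z + t • EuclideanSpace.single (1 : Fin 2) (1 : ℝ) := by
      fun_prop
    have hz' : z + (0 : ℝ) • EuclideanSpace.single (1 : Fin 2) (1 : ℝ) ∈ D := by simpa using hz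
    filter_upwards [hcont.continuousAt (hD.mem_nhds hz')] with t ht
    have h4 := (hφd _ (hD1 _ ht).2.1).1
    simpa [ψ, hz0] using h4
  have h0D : (0 : EuclideanSpace ℝ (Fin 2)) ∈ D := by simp [D, hrT, hr₁]
  have hψ0 : ψ 0 = y₀ := by
    simp only [ψ, PiLp.zero_apply, hc0]
    exact (hφd y₀ (mem_ball_self hrT)).1
  have hψd : HasFDerivAt ψ (fderiv ℝ ψ 0) 0 :=
    ((hψ.contDiffAt (hD.mem_nhds h0D)).differentiableAt (by simp)).hasFDerivAt
  have hA0 : fderiv ℝ ψ 0 (EuclideanSpace.single 0 (1 : ℝ)) = T y₀ := by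
    have := (hψd.hasLineDerivAt (EuclideanSpace.single 0 (1 : ℝ))).unique (hψT 0 h0D)
    rw [this, hψ0, hTT'.self_of_nhds]
  have hA1 : fderiv ℝ ψ 0 (EuclideanSpace.single 1 (1 : ℝ)) = W y₀ := by
    have := (hψd.hasLineDerivAt (EuclideanSpace.single 1 (1 : ℝ))).unique (hψW 0 h0D rfl)
    rw [this, hψ0, hWW'.self_of_nhds]
  -- The derivative sends the standard basis to `T y₀`, `W y₀`, which are independent by `hli`.
  have hinj : Function.Injective (fderiv ℝ ψ 0) := by
    rw [injective_iff_map_eq_zero]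
    intro z hz
    have hdec : z = z 0 • EuclideanSpace.single 0 (1 : ℝ) +
        z 1 • EuclideanSpace.single 1 (1 : ℝ) := by
      ext i
      fin_cases i <;> simp
    rw [hdec, map_add, map_smul, map_smul, hA0, hA1] at hz
    obtain ⟨h0, h1⟩ := hli _ _ hz
    rw [hdec, h0, h1, zero_smul, zero_smul, add_zero]
  let A : EuclideanSpace ℝ (Fin 2) ≃L[ℝ] EuclideanSpace ℝ (Fin 2) :=
    (LinearEquiv.ofInjectiveEndo (fderiv ℝ ψ 0).toLinearMap hinj).toContinuousLinearEquiv
  have hA : (A : EuclideanSpace ℝ (Fin 2) →L[ℝ] EuclideanSpace ℝ (Fin 2)) = fderiv ℝ ψ 0 := by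
    ext z : 1
    rfl
  obtain ⟨Φ, hΦ, h0Φ, hΦD, hΦsymm⟩ := exists_openPartialHomeomorph_of_contDiffOn hD hψ h0D
    (f' := A) (hA ▸ hψd)
  have hgood : ∀ᶠ z in 𝓝 (0 : EuclideanSpace ℝ (Fin 2)),
      z ∈ Φ.source ∧ (T' (ψ z) = T (ψ z) ∧ W' (ψ z) = W (ψ z)) ∧ ψ z ∈ Ω := by
    have hcont : ContinuousAt ψ 0 := hψd.continuousAt
    refine Filter.Eventually.and (Φ.open_source.mem_nhds h0Φ) ?_
    have hev : ∀ᶠ y in 𝓝 (ψ 0), (T' y = T y ∧ W' y = W y) ∧ y ∈ Ω := by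
      rw [hψ0]
      exact (hTT'.and hWW').and (hΩ.mem_nhds hy₀)
    exact hcont.eventually hev
  obtain ⟨r, hr, hrs⟩ := exists_openSquare_subset hgood
  have hsq : Φ.source ∩ openSquare r = openSquare r :=
    inter_eq_right.2 fun z hz ↦ (hrs hz).1
  have hcoe : ⇑(Φ.restrOpen (openSquare r) (isOpen_openSquare r)) = ψ := by simpa using hΦ
  have hsource : (Φ.restrOpen (openSquare r) (isOpen_openSquare r)).source = openSquare r := by
    rw [OpenPartialHomeomorph.restrOpen_source, hsq]
  refine ⟨r, hr, Φ.restrOpen (openSquare r) (isOpen_openSquare r), hsource, ?_, ?_, ?_, ?_, ?_, ?_⟩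
  · rw [hcoe, hψ0]
  · intro y hy
    have hx := (Φ.restrOpen (openSquare r) (isOpen_openSquare r)).map_target hy
    have hr := (Φ.restrOpen (openSquare r) (isOpen_openSquare r)).right_inv hy
    rw [hsource] at hx
    rw [hcoe] at hr
    rw [← hr]
    exact (hrs hx).2.2
  · rw [hcoe, hsource]
    exact hψ.mono fun z hz ↦ hΦD (hrs hz).1
  · refine hΦsymm.mono fun y hy ↦ ?_
    exact hy.1
  · intro z hz
    rw [hcoe, ← (hrs hz).2.1.1]
    exact hψT z (hΦD (hrs hz).1)
  · intro z hz hz0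
    rw [hcoe, ← (hrs hz).2.1.2]
    exact hψW z (hΦD (hrs hz).1) hz0

end FlowBox

/-! ### Algebra of the Christoffel symbols of the first kind. -/

section BilinearForms

variable {E : Type*} [NormedAddCommGroup E] [NormedSpace ℝ E]
  {F : Type*} [NormedAddCommGroup F] [NormedSpace ℝ F]

set_option synthInstance.maxHeartbeats 100000 in
/-- Leibniz rule for a variable bilinear form applied to two variable vectors. -/
theorem hasLineDerivAt_bilinear {g : E → E →L[ℝ] E →L[ℝ] ℝ} {ξ Z W : F → E} {p : F}
    {ξ' Z' W' : F →L[ℝ] E} (hg : DifferentiableAt ℝ g (ξ p)) (hξ : HasFDerivAt ξ ξ' p)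
    (hZ : HasFDerivAt Z Z' p) (hW : HasFDerivAt W W' p) (v : F) :
    HasLineDerivAt ℝ (fun q ↦ g (ξ q) (Z q) (W q))
      (fderiv ℝ g (ξ p) (ξ' v) (Z p) (W p) + g (ξ p) (Z' v) (W p) + g (ξ p) (Z p) (W' v)) p v := by
  have h1 := HasFDerivAt.comp (g := g) p hg.hasFDerivAt hξ
  have h2 := ((h1.clm_apply hZ).clm_apply hW).hasLineDerivAt v
  have h3 : HasLineDerivAt ℝ (fun q ↦ g (ξ q) (Z q) (W q)) (g (ξ p) (Z p) (W' v) +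
      (g (ξ p) (Z' v) (W p) + fderiv ℝ g (ξ p) (ξ' v) (Z p) (W p))) p v := h2
  convert h3 using 1
  ring

/-- The derivative of a family of symmetric bilinear forms is symmetric. -/
theorem fderiv_symm_of_symm {g : E → E →L[ℝ] E →L[ℝ] ℝ} {y : E} (hg : DifferentiableAt ℝ g y)
    (hsymm : ∀ z a b, g z a b = g z b a) (u a b : E) :
    fderiv ℝ g y u a b = fderiv ℝ g y u b a := by
  have h1 := hasLineDerivAt_bilinear (ξ := fun z ↦ z) (Z := fun _ ↦ a) (W := fun _ ↦ b) hg
    (hasFDerivAt_id y) (hasFDerivAt_const a y) (hasFDerivAt_const b y) u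
  have h2 := hasLineDerivAt_bilinear (ξ := fun z ↦ z) (Z := fun _ ↦ b) (W := fun _ ↦ a) hg
    (hasFDerivAt_id y) (hasFDerivAt_const b y) (hasFDerivAt_const a y) u
  simp only [hsymm _ b a] at h2
  simpa using h1.unique h2

theorem christoffelFirst_apply (g : E → E →L[ℝ] E →L[ℝ] ℝ) (y v w u : E) :
    christoffelFirst g y v w u =
      2⁻¹ * (fderiv ℝ g y v w u + fderiv ℝ g y w v u - fderiv ℝ g y u v w) := rfl

set_option synthInstance.maxHeartbeats 200000 in
theorem christoffelFirst_add_right (g : E → E →L[ℝ] E →L[ℝ] ℝ) (y v w w' : E) :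
    christoffelFirst g y v (w + w') = christoffelFirst g y v w + christoffelFirst g y v w' := by
  ext u
  simp only [christoffelFirst_apply, map_add, add_apply]
  ring

set_option synthInstance.maxHeartbeats 200000 in
theorem christoffelFirst_smul_right (g : E → E →L[ℝ] E →L[ℝ] ℝ) (y v w : E) (c : ℝ) :
    christoffelFirst g y v (c • w) = c • christoffelFirst g y v w := by
  ext u
  simp only [christoffelFirst_apply, map_smul, smul_apply, smul_eq_mul]
  ring

end BilinearForms

section ChristoffelSymmetry

variable {E : Type*} [NormedAddCommGroup E] [NormedSpace ℝ E] {g : E → E →L[ℝ] E →L[ℝ] ℝ} {y : E}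

/-- The source of torsion-freeness. -/
theorem christoffelFirst_symm (hg : ∀ u a b, fderiv ℝ g y u a b = fderiv ℝ g y u b a)
    (v w u : E) : christoffelFirst g y v w u = christoffelFirst g y w v u := by
  rw [christoffelFirst_apply, christoffelFirst_apply, hg u v w]
  ring

/-- The derivatives in the directions `z` and `w` cancel in the sum. This is metric compatibility in
coordinates. -/
theorem christoffelFirst_add_swap (hg : ∀ u a b, fderiv ℝ g y u a b = fderiv ℝ g y u b a)
    (v z w : E) :
    christoffelFirst g y v z w + christoffelFirst g y v w z = fderiv ℝ g y v z w := by
  rw [christoffelFirst_apply, christoffelFirst_apply, hg v w z]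
  ring

end ChristoffelSymmetry

/-! ### Tangent vectors, metric and Christoffel symbols in a chart. -/

section Calculus

variable {E : Type*} [NormedAddCommGroup E] [NormedSpace ℝ E]
  {M : Type*} [TopologicalSpace M] [ChartedSpace E M] [IsManifold 𝓘(ℝ, E) ∞ M]

/-- The coordinates of a tangent vector in the preferred chart around `x₀`. -/
def tangentCoord (x₀ : M) (x : M) (v : TangentSpace 𝓘(ℝ, E) x) : E :=
  (trivializationAt E (TangentSpace 𝓘(ℝ, E) : M → Type _) x₀ ⟨x, v⟩).2

theorem tangentCoord_eq_continuousLinearMapAt {x₀ x : M} (hx : x ∈ (chartAt E x₀).source)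
    (v : TangentSpace 𝓘(ℝ, E) x) :
    tangentCoord x₀ x v =
      (trivializationAt E (TangentSpace 𝓘(ℝ, E) : M → Type _) x₀).continuousLinearMapAt ℝ x v := by
  rw [Trivialization.continuousLinearMapAt_apply, Trivialization.linearMapAt_apply]
  rw [if_pos (by simpa using hx)]
  rfl

theorem tangentCoord_eq_mfderiv {x₀ x : M} (hx : x ∈ (chartAt E x₀).source)
    (v : TangentSpace 𝓘(ℝ, E) x) :
    tangentCoord x₀ x v = mfderiv 𝓘(ℝ, E) 𝓘(ℝ, E) (extChartAt 𝓘(ℝ, E) x₀) x v := by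
  rw [tangentCoord_eq_continuousLinearMapAt hx,
    TangentBundle.continuousLinearMapAt_trivializationAt hx]
  rfl

theorem tangentCoord_self (x : M) (v : TangentSpace 𝓘(ℝ, E) x) : tangentCoord x x v = v := by
  rw [tangentCoord_eq_mfderiv (mem_chart_source E x), mfderiv_extChartAt_self]
  rfl

theorem tangentCoord_add {x₀ x : M} (hx : x ∈ (chartAt E x₀).source)
    (v w : TangentSpace 𝓘(ℝ, E) x) :
    tangentCoord x₀ x (v + w) = tangentCoord x₀ x v + tangentCoord x₀ x w := by
  simp only [tangentCoord_eq_continuousLinearMapAt hx, map_add]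

theorem tangentCoord_smul {x₀ x : M} (hx : x ∈ (chartAt E x₀).source) (c : ℝ)
    (v : TangentSpace 𝓘(ℝ, E) x) :
    tangentCoord x₀ x (c • v) = c • tangentCoord x₀ x v := by
  simp only [tangentCoord_eq_continuousLinearMapAt hx, map_smul]

theorem symmL_tangentCoord {x₀ x : M} (hx : x ∈ (chartAt E x₀).source)
    (v : TangentSpace 𝓘(ℝ, E) x) :
    (trivializationAt E (TangentSpace 𝓘(ℝ, E) : M → Type _) x₀).symmL ℝ x (tangentCoord x₀ x v)
      = v := by
  rw [tangentCoord_eq_continuousLinearMapAt hx]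
  exact (trivializationAt E (TangentSpace 𝓘(ℝ, E) : M → Type _) x₀).symmL_continuousLinearMapAt
    (by simpa using hx) v

theorem contMDiffOn_symmL (x₀ : M) (v : E) :
    ContMDiffOn 𝓘(ℝ, E) 𝓘(ℝ, E).tangent ∞ (fun y : E ↦
      (⟨(extChartAt 𝓘(ℝ, E) x₀).symm y,
        (trivializationAt E (TangentSpace 𝓘(ℝ, E) : M → Type _) x₀).symmL ℝ
          ((extChartAt 𝓘(ℝ, E) x₀).symm y) v⟩ : TangentBundle 𝓘(ℝ, E) M))
      (extChartAt 𝓘(ℝ, E) x₀).target := by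
  have h1 : ContMDiffOn 𝓘(ℝ, E) (𝓘(ℝ, E).prod 𝓘(ℝ, E)) ∞
      (fun y : E ↦ ((extChartAt 𝓘(ℝ, E) x₀).symm y, v)) (extChartAt 𝓘(ℝ, E) x₀).target :=
    (contMDiffOn_extChartAt_symm x₀).prodMk contMDiffOn_const
  have hb : ∀ y ∈ (extChartAt 𝓘(ℝ, E) x₀).target, (extChartAt 𝓘(ℝ, E) x₀).symm y ∈
      (trivializationAt E (TangentSpace 𝓘(ℝ, E) : M → Type _) x₀).baseSet := by
    intro y hy
    simpa using (extChartAt 𝓘(ℝ, E) x₀).map_target hy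
  have h2 := (trivializationAt E (TangentSpace 𝓘(ℝ, E) : M → Type _) x₀).contMDiffOn_symm
    (n := ∞) (IB := 𝓘(ℝ, E))
  refine (h2.comp h1 fun y hy ↦ ?_).congr fun y hy ↦ ?_
  · rw [Trivialization.target_eq]
    exact ⟨hb y hy, mem_univ _⟩
  · rw [Trivialization.symmL_apply (R := ℝ) _ (hb y hy)]
    exact (trivializationAt E (TangentSpace 𝓘(ℝ, E) : M → Type _) x₀).mk_symm (hb y hy) v

variable [RiemannianBundle (fun x : M ↦ TangentSpace 𝓘(ℝ, E) x)]

theorem metricInChart_tangentCoord {x₀ x : M} (hx : x ∈ (chartAt E x₀).source)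
    (v w : TangentSpace 𝓘(ℝ, E) x) :
    metricInChart x₀ (extChartAt 𝓘(ℝ, E) x₀ x) (tangentCoord x₀ x v) (tangentCoord x₀ x w)
      = inner ℝ v w := by
  have hx' : (extChartAt 𝓘(ℝ, E) x₀).symm (extChartAt 𝓘(ℝ, E) x₀ x) = x :=
    (extChartAt 𝓘(ℝ, E) x₀).left_inv (by simpa using hx)
  -- The fibre carrying the inner product depends on the point, so the equality of points is used by
  -- substitution in a statement about a variable point.
  have key : ∀ x' : M, x' = x → ∀ a b : E,
      (innerSL ℝ (E := TangentSpace 𝓘(ℝ, E) x')).bilinearComp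
        ((trivializationAt E (TangentSpace 𝓘(ℝ, E) : M → Type _) x₀).symmL ℝ x')
        ((trivializationAt E (TangentSpace 𝓘(ℝ, E) : M → Type _) x₀).symmL ℝ x') a b =
      inner ℝ ((trivializationAt E (TangentSpace 𝓘(ℝ, E) : M → Type _) x₀).symmL ℝ x a)
        ((trivializationAt E (TangentSpace 𝓘(ℝ, E) : M → Type _) x₀).symmL ℝ x b) := by
    rintro x' rfl a b
    rfl
  refine (key _ hx' _ _).trans ?_
  rw [symmL_tangentCoord hx, symmL_tangentCoord hx]

theorem metricInChart_self (x : M) (v w : TangentSpace 𝓘(ℝ, E) x) :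
    metricInChart x (extChartAt 𝓘(ℝ, E) x x) v w = inner ℝ v w := by
  have h := metricInChart_tangentCoord (mem_chart_source E x) v w
  rwa [tangentCoord_self, tangentCoord_self] at h

theorem metricInChart_symm (x₀ : M) (y a b : E) :
    metricInChart x₀ y a b = metricInChart x₀ y b a :=
  real_inner_comm (F := TangentSpace 𝓘(ℝ, E) ((extChartAt 𝓘(ℝ, E) x₀).symm y))
    ((trivializationAt E (TangentSpace 𝓘(ℝ, E) : M → Type _) x₀).symmL ℝ _ b)
    ((trivializationAt E (TangentSpace 𝓘(ℝ, E) : M → Type _) x₀).symmL ℝ _ a)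

/-- The Riesz representation raises the index. Identities for `christoffel` are proved by pairing
with an arbitrary `u` and using those of the first kind. -/
theorem inner_christoffel [FiniteDimensional ℝ E] (x₀ : M) (v w u : TangentSpace 𝓘(ℝ, E) x₀) :
    inner ℝ (christoffel x₀ v w) u =
      christoffelFirst (E := E) (metricInChart x₀) (extChartAt 𝓘(ℝ, E) x₀ x₀) v w u := by
  have : FiniteDimensional ℝ (TangentSpace 𝓘(ℝ, E) x₀) :=
    inferInstanceAs (FiniteDimensional ℝ E)
  have : CompleteSpace (TangentSpace 𝓘(ℝ, E) x₀) := FiniteDimensional.complete ℝ _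
  exact InnerProductSpace.toDual_symm_apply

theorem christoffel_add_right [FiniteDimensional ℝ E] (x₀ : M)
    (v w w' : TangentSpace 𝓘(ℝ, E) x₀) :
    christoffel x₀ v (w + w') = christoffel x₀ v w + christoffel x₀ v w' := by
  refine ext_inner_right ℝ fun u ↦ ?_
  rw [inner_add_left, inner_christoffel, inner_christoffel, inner_christoffel]
  exact DFunLike.congr_fun (christoffelFirst_add_right (E := E) _ _ v w w') u

theorem christoffel_smul_right [FiniteDimensional ℝ E] (x₀ : M)
    (v w : TangentSpace 𝓘(ℝ, E) x₀) (c : ℝ) :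
    christoffel x₀ v (c • w) = c • christoffel x₀ v w := by
  refine ext_inner_right ℝ fun u ↦ ?_
  rw [real_inner_smul_left, inner_christoffel, inner_christoffel]
  exact DFunLike.congr_fun (christoffelFirst_smul_right (E := E) _ _ v w c) u

variable [IsContMDiffRiemannianBundle 𝓘(ℝ, E) ∞ E (fun x : M ↦ TangentSpace 𝓘(ℝ, E) x)]

/-- In finite dimension, smoothness of an operator-valued map can be tested on fixed vectors; each
entry is then the inner product of two smooth sections. -/
theorem contDiffOn_metricInChart [FiniteDimensional ℝ E] (x₀ : M) :
    ContDiffOn ℝ ∞ (metricInChart x₀) (extChartAt 𝓘(ℝ, E) x₀).target := by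
  rw [contDiffOn_clm_apply]
  intro v
  rw [contDiffOn_clm_apply]
  intro w
  rw [← contMDiffOn_iff_contDiffOn]
  exact ContMDiffOn.inner_bundle (E := fun x : M ↦ TangentSpace 𝓘(ℝ, E) x)
    (b := (extChartAt 𝓘(ℝ, E) x₀).symm) (contMDiffOn_symmL x₀ v) (contMDiffOn_symmL x₀ w)

theorem differentiableAt_metricInChart [FiniteDimensional ℝ E] (x₀ : M) :
    DifferentiableAt ℝ (metricInChart x₀) (extChartAt 𝓘(ℝ, E) x₀ x₀) :=
  ((contDiffOn_metricInChart x₀).contDiffAt (extChartAt_target_mem_nhds x₀)).differentiableAt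
    (by simp)

theorem fderiv_metricInChart_symm [FiniteDimensional ℝ E] (x₀ : M) (u a b : E) :
    fderiv ℝ (metricInChart x₀) (extChartAt 𝓘(ℝ, E) x₀ x₀) u a b =
      fderiv ℝ (metricInChart x₀) (extChartAt 𝓘(ℝ, E) x₀ x₀) u b a :=
  fderiv_symm_of_symm (differentiableAt_metricInChart x₀) (metricInChart_symm x₀) u a b

theorem inner_christoffel_add (x₀ : M) [FiniteDimensional ℝ E] (v z w : TangentSpace 𝓘(ℝ, E) x₀) :
    inner ℝ (christoffel x₀ v z) w + inner ℝ z (christoffel x₀ v w) =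
      fderiv ℝ (metricInChart (E := E) x₀) (extChartAt 𝓘(ℝ, E) x₀ x₀) v z w := by
  have h1 := inner_christoffel x₀ v z w
  have h2 := inner_christoffel x₀ v w z
  have h3 := christoffelFirst_add_swap (E := E) (fderiv_metricInChart_symm x₀) v z w
  rw [real_inner_comm] at h2
  rw [h1, h2]
  exact h3

theorem christoffel_symm (x₀ : M) [FiniteDimensional ℝ E] (v w : TangentSpace 𝓘(ℝ, E) x₀) :
    christoffel x₀ v w = christoffel x₀ w v := by
  refine ext_inner_right ℝ fun u ↦ ?_
  rw [inner_christoffel, inner_christoffel]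
  exact christoffelFirst_symm (E := E) (fderiv_metricInChart_symm x₀) v w u

end Calculus

/-! ### The covariant derivative along a map: chain rule, linearity, metric compatibility, symmetry.
-/

section CovariantDerivative

variable {E : Type*} [NormedAddCommGroup E] [NormedSpace ℝ E]
  {M : Type*} [TopologicalSpace M] [ChartedSpace E M]
  {F : Type*} [NormedAddCommGroup F] [NormedSpace ℝ F]
  {N : Type*} [TopologicalSpace N] [ChartedSpace F N]

section Differentiability

variable {φ : N → M} {Z : ∀ q, TangentSpace 𝓘(ℝ, E) (φ q)} {p : N}

theorem eventually_mem_chart_source (hφ : MDifferentiableAt 𝓘(ℝ, F) 𝓘(ℝ, E) φ p) :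
    ∀ᶠ q in 𝓝 p, φ q ∈ (chartAt E (φ p)).source :=
  hφ.continuousAt.eventually
    ((chartAt E (φ p)).open_source.mem_nhds (mem_chart_source E (φ p)))

variable [IsManifold 𝓘(ℝ, E) ∞ M]

theorem mdifferentiableAt_of_field
    (hZ : MDifferentiableAt 𝓘(ℝ, F) 𝓘(ℝ, E).tangent
      (fun q ↦ (⟨φ q, Z q⟩ : TangentBundle 𝓘(ℝ, E) M)) p) :
    MDifferentiableAt 𝓘(ℝ, F) 𝓘(ℝ, E) φ p :=
  ((mdifferentiableAt_totalSpace _ _).1 hZ).1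

theorem mdifferentiableAt_tangentCoord
    (hZ : MDifferentiableAt 𝓘(ℝ, F) 𝓘(ℝ, E).tangent
      (fun q ↦ (⟨φ q, Z q⟩ : TangentBundle 𝓘(ℝ, E) M)) p) :
    MDifferentiableAt 𝓘(ℝ, F) 𝓘(ℝ, E) (fun q ↦ tangentCoord (φ p) (φ q) (Z q)) p :=
  ((mdifferentiableAt_totalSpace _ _).1 hZ).2

end Differentiability

variable [IsManifold 𝓘(ℝ, E) ∞ M]

theorem hasFDerivAt_extChartAt_comp {Φ : F → M} {p : F} {x₀ : M} (hx : Φ p ∈ (chartAt E x₀).source)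
    (hΦ : MDifferentiableAt 𝓘(ℝ, F) 𝓘(ℝ, E) Φ p) :
    DifferentiableAt ℝ (fun q ↦ extChartAt 𝓘(ℝ, E) x₀ (Φ q)) p ∧
    ∀ v : F, fderiv ℝ (fun q ↦ extChartAt 𝓘(ℝ, E) x₀ (Φ q)) p v =
      tangentCoord x₀ (Φ p) (mfderiv 𝓘(ℝ, F) 𝓘(ℝ, E) Φ p v) := by
  have h1 : MDifferentiableAt 𝓘(ℝ, E) 𝓘(ℝ, E) (extChartAt 𝓘(ℝ, E) x₀) (Φ p) :=
    mdifferentiableAt_extChartAt hx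
  have h2 : MDifferentiableAt 𝓘(ℝ, F) 𝓘(ℝ, E) (fun q ↦ extChartAt 𝓘(ℝ, E) x₀ (Φ q)) p :=
    h1.comp p hΦ
  refine ⟨mdifferentiableAt_iff_differentiableAt.1 h2, fun v ↦ ?_⟩
  rw [tangentCoord_eq_mfderiv hx, ← mfderiv_eq_fderiv]
  exact DFunLike.congr_fun (mfderiv_comp p h1 hΦ) v

/-- The derivative of the coordinates of a vector field along a map, in the preferred chart around
the image point. -/
def coordDeriv (φ : N → M) (Z : ∀ q, TangentSpace 𝓘(ℝ, E) (φ q)) (p : N)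
    (v : TangentSpace 𝓘(ℝ, F) p) : TangentSpace 𝓘(ℝ, E) (φ p) :=
  mfderiv 𝓘(ℝ, F) 𝓘(ℝ, E) (fun q ↦ tangentCoord (φ p) (φ q) (Z q)) p v

variable [FiniteDimensional ℝ E] [RiemannianBundle (fun x : M ↦ TangentSpace 𝓘(ℝ, E) x)]

theorem covDerivAlong_eq (φ : N → M) (Z : ∀ q, TangentSpace 𝓘(ℝ, E) (φ q)) (p : N)
    (v : TangentSpace 𝓘(ℝ, F) p) :
    covDerivAlong φ Z p v =
      coordDeriv φ Z p v + christoffel (φ p) (mfderiv 𝓘(ℝ, F) 𝓘(ℝ, E) φ p v) (Z p) := rfl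

theorem covDerivAlong_congr {φ : N → M} {Z Z' : ∀ q, TangentSpace 𝓘(ℝ, E) (φ q)} {p : N}
    (h : ∀ᶠ q in 𝓝 p, Z q = Z' q) (v : TangentSpace 𝓘(ℝ, F) p) :
    covDerivAlong φ Z p v = covDerivAlong φ Z' p v := by
  have h1 : (fun q ↦ tangentCoord (φ p) (φ q) (Z q)) =ᶠ[𝓝 p]
      fun q ↦ tangentCoord (φ p) (φ q) (Z' q) := by
    filter_upwards [h] with q hq
    rw [hq]
  have h2 : coordDeriv φ Z p v = coordDeriv φ Z' p v := DFunLike.congr_fun h1.mfderiv_eq v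
  rw [covDerivAlong_eq, covDerivAlong_eq, h2, h.self_of_nhds]

/-- Chain rule for the covariant derivative along a map. -/
theorem covDerivAlong_comp {F' : Type*} [NormedAddCommGroup F'] [NormedSpace ℝ F']
    {N' : Type*} [TopologicalSpace N'] [ChartedSpace F' N'] {φ : N → M}
    {Z : ∀ q, TangentSpace 𝓘(ℝ, E) (φ q)} {h : N' → N} {p : N'}
    (hZ : MDifferentiableAt 𝓘(ℝ, F) 𝓘(ℝ, E).tangent
      (fun q ↦ (⟨φ q, Z q⟩ : TangentBundle 𝓘(ℝ, E) M)) (h p))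
    (hh : MDifferentiableAt 𝓘(ℝ, F') 𝓘(ℝ, F) h p) (v : TangentSpace 𝓘(ℝ, F') p) :
    covDerivAlong (fun q ↦ φ (h q)) (fun q ↦ Z (h q)) p v =
      covDerivAlong φ Z (h p) (mfderiv 𝓘(ℝ, F') 𝓘(ℝ, F) h p v) := by
  rw [covDerivAlong_eq, covDerivAlong_eq]
  have h1 := mfderiv_comp p (mdifferentiableAt_tangentCoord hZ) hh
  have h2 := mfderiv_comp p (mdifferentiableAt_of_field hZ) hh
  have h1' := DFunLike.congr_fun h1 v
  have h2' := DFunLike.congr_fun h2 v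
  exact congrArg₂ (fun a b : TangentSpace 𝓘(ℝ, E) (φ (h p)) ↦
    a + christoffel (φ (h p)) b (Z (h p))) h1' h2'

theorem covDerivAlong_add {φ : N → M} {Z W : ∀ q, TangentSpace 𝓘(ℝ, E) (φ q)} {p : N}
    (hZ : MDifferentiableAt 𝓘(ℝ, F) 𝓘(ℝ, E).tangent
      (fun q ↦ (⟨φ q, Z q⟩ : TangentBundle 𝓘(ℝ, E) M)) p)
    (hW : MDifferentiableAt 𝓘(ℝ, F) 𝓘(ℝ, E).tangent
      (fun q ↦ (⟨φ q, W q⟩ : TangentBundle 𝓘(ℝ, E) M)) p) (v : TangentSpace 𝓘(ℝ, F) p) :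
    covDerivAlong φ (fun q ↦ Z q + W q) p v = covDerivAlong φ Z p v + covDerivAlong φ W p v := by
  have h1 : (fun q ↦ tangentCoord (φ p) (φ q) (Z q + W q)) =ᶠ[𝓝 p]
      (fun q ↦ tangentCoord (φ p) (φ q) (Z q)) + fun q ↦ tangentCoord (φ p) (φ q) (W q) := by
    filter_upwards [eventually_mem_chart_source (mdifferentiableAt_of_field hZ)] with q hq
    exact tangentCoord_add hq _ _
  have h2 := mfderiv_add (mdifferentiableAt_tangentCoord hZ) (mdifferentiableAt_tangentCoord hW)
  have h3 : coordDeriv φ (fun q ↦ Z q + W q) p v = coordDeriv φ Z p v + coordDeriv φ W p v :=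
    DFunLike.congr_fun (h1.mfderiv_eq.trans h2) v
  rw [covDerivAlong_eq, covDerivAlong_eq, covDerivAlong_eq, christoffel_add_right, h3]
  abel

theorem covDerivAlong_const_smul {φ : N → M} {Z : ∀ q, TangentSpace 𝓘(ℝ, E) (φ q)} {p : N}
    (hZ : MDifferentiableAt 𝓘(ℝ, F) 𝓘(ℝ, E).tangent
      (fun q ↦ (⟨φ q, Z q⟩ : TangentBundle 𝓘(ℝ, E) M)) p) (c : ℝ) (v : TangentSpace 𝓘(ℝ, F) p) :
    covDerivAlong φ (fun q ↦ c • Z q) p v = c • covDerivAlong φ Z p v := by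
  have h1 : (fun q ↦ tangentCoord (φ p) (φ q) (c • Z q)) =ᶠ[𝓝 p]
      c • (fun q ↦ tangentCoord (φ p) (φ q) (Z q)) := by
    filter_upwards [eventually_mem_chart_source (mdifferentiableAt_of_field hZ)] with q hq
    exact tangentCoord_smul hq _ _
  have h2 := const_smul_mfderiv (mdifferentiableAt_tangentCoord hZ) c
  have h3 : coordDeriv φ (fun q ↦ c • Z q) p v = c • coordDeriv φ Z p v :=
    DFunLike.congr_fun (h1.mfderiv_eq.trans h2) v
  rw [covDerivAlong_eq, covDerivAlong_eq, christoffel_smul_right, h3, smul_add]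

section VectorSpaceSource

variable {Φ : F → M}

variable [IsContMDiffRiemannianBundle 𝓘(ℝ, E) ∞ E (fun x : M ↦ TangentSpace 𝓘(ℝ, E) x)]

/-- The covariant derivative along a map is compatible with the metric. -/
theorem hasLineDerivAt_inner {Z W : ∀ q, TangentSpace 𝓘(ℝ, E) (Φ q)} {p : F}
    (hZ : MDifferentiableAt 𝓘(ℝ, F) 𝓘(ℝ, E).tangent
      (fun q ↦ (⟨Φ q, Z q⟩ : TangentBundle 𝓘(ℝ, E) M)) p)
    (hW : MDifferentiableAt 𝓘(ℝ, F) 𝓘(ℝ, E).tangent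
      (fun q ↦ (⟨Φ q, W q⟩ : TangentBundle 𝓘(ℝ, E) M)) p) (v : F) :
    HasLineDerivAt ℝ (fun q ↦ inner ℝ (Z q) (W q))
      (inner ℝ (covDerivAlong Φ Z p v) (W p) + inner ℝ (Z p) (covDerivAlong Φ W p v)) p v := by
  have hΦ := mdifferentiableAt_of_field hZ
  obtain ⟨hξ, hξ'⟩ := hasFDerivAt_extChartAt_comp (mem_chart_source E (Φ p)) hΦ
  have hZ' : HasFDerivAt (fun q ↦ tangentCoord (Φ p) (Φ q) (Z q)) _ p :=
    hasMFDerivAt_iff_hasFDerivAt.1 (mdifferentiableAt_tangentCoord hZ).hasMFDerivAt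
  have hW' : HasFDerivAt (fun q ↦ tangentCoord (Φ p) (Φ q) (W q)) _ p :=
    hasMFDerivAt_iff_hasFDerivAt.1 (mdifferentiableAt_tangentCoord hW).hasMFDerivAt
  have key := hasLineDerivAt_bilinear (E := E) (g := metricInChart (Φ p))
    (ξ := fun q ↦ extChartAt 𝓘(ℝ, E) (Φ p) (Φ q))
    (differentiableAt_metricInChart (Φ p)) hξ.hasFDerivAt hZ' hW' v
  rw [hξ' v, tangentCoord_self, tangentCoord_self, tangentCoord_self] at key
  have hfun : (fun q ↦ inner ℝ (Z q) (W q)) =ᶠ[𝓝 p] fun q ↦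
      metricInChart (Φ p) (extChartAt 𝓘(ℝ, E) (Φ p) (Φ q)) (tangentCoord (Φ p) (Φ q) (Z q))
        (tangentCoord (Φ p) (Φ q) (W q)) := by
    filter_upwards [eventually_mem_chart_source hΦ] with q hq
    exact (metricInChart_tangentCoord hq _ _).symm
  have hcont : ContinuousAt (fun t : ℝ ↦ p + t • v) 0 := by fun_prop
  have hfun' := (show Tendsto (fun t : ℝ ↦ p + t • v) (𝓝 0) (𝓝 p) by
    simpa [ContinuousAt] using hcont).eventually hfun
  have key' : HasLineDerivAt ℝ (fun q ↦ inner ℝ (Z q) (W q)) _ p v :=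
    HasDerivAt.congr_of_eventuallyEq key hfun'
  convert key' using 1
  have hC := inner_christoffel_add (Φ p) (mfderiv 𝓘(ℝ, F) 𝓘(ℝ, E) Φ p v) (Z p) (W p)
  have hA := metricInChart_self (Φ p) (coordDeriv (F := F) Φ Z p v) (W p)
  have hB := metricInChart_self (Φ p) (Z p) (coordDeriv (F := F) Φ W p v)
  have hP := inner_add_left (𝕜 := ℝ) (coordDeriv (F := F) Φ Z p v)
    (christoffel (Φ p) (mfderiv 𝓘(ℝ, F) 𝓘(ℝ, E) Φ p v) (Z p)) (W p)
  have hQ := inner_add_right (𝕜 := ℝ) (Z p) (coordDeriv (F := F) Φ W p v)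
    (christoffel (Φ p) (mfderiv 𝓘(ℝ, F) 𝓘(ℝ, E) Φ p v) (W p))
  -- Some terms are typed in `E` and others in the tangent space at `Φ p`, which agree only by
  -- unfolding. The arithmetic is therefore done on abstract reals and matched by unification.
  have alg : ∀ {P Q a₁ a₂ c₁ c₂ C A B : ℝ}, P = a₁ + c₁ → Q = a₂ + c₂ → c₁ + c₂ = C → A = a₁ →
      B = a₂ → P + Q = C + A + B := by
    intros
    linarith
  exact alg hP hQ hC hA hB

/-- The covariant derivative along a map is torsion free. -/
theorem covDerivAlong_mfderiv_symm {s : Set F} (hs : IsOpen s)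
    (hΦ : ContMDiffOn 𝓘(ℝ, F) 𝓘(ℝ, E) ∞ Φ s) {p : F} (hp : p ∈ s) (a b : F) :
    covDerivAlong (F := F) Φ (fun q ↦ mfderiv 𝓘(ℝ, F) 𝓘(ℝ, E) Φ q b) p a =
      covDerivAlong (F := F) Φ (fun q ↦ mfderiv 𝓘(ℝ, F) 𝓘(ℝ, E) Φ q a) p b := by
  have hd : ∀ q ∈ s, MDifferentiableAt 𝓘(ℝ, F) 𝓘(ℝ, E) Φ q := fun q hq ↦
    (hΦ.contMDiffAt (hs.mem_nhds hq)).mdifferentiableAt (by simp)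
  let ξ : F → E := fun q ↦ extChartAt 𝓘(ℝ, E) (Φ p) (Φ q)
  have hξ : ContDiffAt ℝ ∞ ξ p := by
    rw [← contMDiffAt_iff_contDiffAt]
    exact (contMDiffAt_extChartAt (x := Φ p)).comp p (hΦ.contMDiffAt (hs.mem_nhds hp))
  -- In the chart, the field `dΦ(c)` has coordinates `dξ(c)`, so its coordinate derivative is a
  -- second derivative of `ξ`, which is symmetric.
  have hcoord : ∀ c : F, (fun q ↦ tangentCoord (Φ p) (Φ q) (mfderiv 𝓘(ℝ, F) 𝓘(ℝ, E) Φ q c))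
      =ᶠ[𝓝 p] fun q ↦ fderiv ℝ ξ q c := by
    intro c
    filter_upwards [eventually_mem_chart_source (hd p hp), hs.mem_nhds hp] with q hq hqs
    exact ((hasFDerivAt_extChartAt_comp hq (hd q hqs)).2 c).symm
  have hdξ : DifferentiableAt ℝ (fderiv ℝ ξ) p :=
    (hξ.fderiv_right (m := 1) (by norm_cast)).differentiableAt (by simp)
  have hder : ∀ c e : F, mfderiv 𝓘(ℝ, F) 𝓘(ℝ, E)
      (fun q ↦ tangentCoord (Φ p) (Φ q) (mfderiv 𝓘(ℝ, F) 𝓘(ℝ, E) Φ q c)) p e =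
      fderiv ℝ (fderiv ℝ ξ) p e c := by
    intro c e
    rw [(hcoord c).mfderiv_eq, mfderiv_eq_fderiv]
    have := (hdξ.hasFDerivAt.clm_apply (hasFDerivAt_const c p)).fderiv
    rw [this]
    simp only [ContinuousLinearMap.comp_zero, zero_add]
    rfl
  have hsymm := (hξ.isSymmSndFDerivAt (by simp; norm_cast)).eq a b
  have h1 : coordDeriv (F := F) Φ (fun q ↦ mfderiv 𝓘(ℝ, F) 𝓘(ℝ, E) Φ q b) p a =
      coordDeriv (F := F) Φ (fun q ↦ mfderiv 𝓘(ℝ, F) 𝓘(ℝ, E) Φ q a) p b :=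
    (hder b a).trans (hsymm.trans (hder a b).symm)
  have h2 := christoffel_symm (Φ p) (mfderiv 𝓘(ℝ, F) 𝓘(ℝ, E) Φ p a)
    (mfderiv 𝓘(ℝ, F) 𝓘(ℝ, E) Φ p b)
  exact congrArg₂ (· + ·) h1 h2

end VectorSpaceSource

end CovariantDerivative

/-! ### Smooth fields along a map and their lifts to the source. -/

section CoordinateFields

variable {E : Type*} [NormedAddCommGroup E] [NormedSpace ℝ E]
  {M : Type*} [TopologicalSpace M] [ChartedSpace E M] [IsManifold 𝓘(ℝ, E) ∞ M]
  {F : Type*} [NormedAddCommGroup F] [NormedSpace ℝ F] {Φ : F → M} {s : Set F}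

theorem contDiffOn_extChartAt_comp (hs : IsOpen s) (hΦ : ContMDiffOn 𝓘(ℝ, F) 𝓘(ℝ, E) ∞ Φ s)
    (x₀ : M) :
    IsOpen (s ∩ Φ ⁻¹' (chartAt E x₀).source) ∧
      ContDiffOn ℝ ∞ (fun q ↦ extChartAt 𝓘(ℝ, E) x₀ (Φ q))
        (s ∩ Φ ⁻¹' (chartAt E x₀).source) := by
  refine ⟨hΦ.continuousOn.isOpen_inter_preimage hs (chartAt E x₀).open_source, ?_⟩
  rw [← contMDiffOn_iff_contDiffOn]
  exact (contMDiffOn_extChartAt (I := 𝓘(ℝ, E)) (x := x₀)).comp (hΦ.mono inter_subset_left)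
    fun q hq ↦ hq.2

/-- The image of a constant vector field under the differential of a smooth map is a smooth field
along the map. -/
theorem contMDiffOn_mfderiv_apply (hs : IsOpen s) (hΦ : ContMDiffOn 𝓘(ℝ, F) 𝓘(ℝ, E) ∞ Φ s)
    (a : F) :
    ContMDiffOn 𝓘(ℝ, F) 𝓘(ℝ, E).tangent ∞
      (fun q ↦ (⟨Φ q, mfderiv 𝓘(ℝ, F) 𝓘(ℝ, E) Φ q a⟩ : TangentBundle 𝓘(ℝ, E) M)) s := by
  intro p hp
  have hd : ∀ q ∈ s, MDifferentiableAt 𝓘(ℝ, F) 𝓘(ℝ, E) Φ q := fun q hq ↦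
    (hΦ.contMDiffAt (hs.mem_nhds hq)).mdifferentiableAt (by simp)
  obtain ⟨ho, hξ⟩ := contDiffOn_extChartAt_comp hs hΦ (Φ p)
  have hp' : p ∈ s ∩ Φ ⁻¹' (chartAt E (Φ p)).source := ⟨hp, mem_chart_source E (Φ p)⟩
  have hξp := hξ.contDiffAt (ho.mem_nhds hp')
  have h1 : ContMDiffAt 𝓘(ℝ, F) 𝓘(ℝ, E) ∞
      (fun q ↦ fderiv ℝ (fun q ↦ extChartAt 𝓘(ℝ, E) (Φ p) (Φ q)) q a) p := by
    rw [contMDiffAt_iff_contDiffAt]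
    exact (hξp.fderiv_right (m := ∞) (by norm_cast)).clm_apply contDiffAt_const
  refine ContMDiffAt.contMDiffWithinAt ?_
  rw [contMDiffAt_totalSpace]
  refine ⟨hΦ.contMDiffAt (hs.mem_nhds hp), h1.congr_of_eventuallyEq ?_⟩
  filter_upwards [ho.mem_nhds hp'] with q hq
  exact ((hasFDerivAt_extChartAt_comp hq.2 (hd q hq.1)).2 a).symm

/-- The coordinates of a smooth field along a map are smooth. -/
theorem contDiffOn_tangentCoord {Z : ∀ q, TangentSpace 𝓘(ℝ, E) (Φ q)}
    (hZ : ContMDiffOn 𝓘(ℝ, F) 𝓘(ℝ, E).tangent ∞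
      (fun q ↦ (⟨Φ q, Z q⟩ : TangentBundle 𝓘(ℝ, E) M)) s) (x₀ : M) :
    ContDiffOn ℝ ∞ (fun q ↦ tangentCoord x₀ (Φ q) (Z q)) (s ∩ Φ ⁻¹' (chartAt E x₀).source) := by
  rw [← contMDiffOn_iff_contDiffOn]
  have h := (trivializationAt E (TangentSpace 𝓘(ℝ, E) : M → Type _) x₀).contMDiffOn
    (n := ∞) (IB := 𝓘(ℝ, E))
  have h2 := h.comp (hZ.mono (inter_subset_left (t := Φ ⁻¹' (chartAt E x₀).source)))
    fun q hq ↦ by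
      rw [mem_preimage, Trivialization.mem_source]
      simpa using hq.2
  exact contMDiff_snd.comp_contMDiffOn h2

/-- A smooth field along an immersion that is everywhere tangent to it is locally the image of a
smooth vector field of the source. -/
theorem exists_contDiffOn_lift [FiniteDimensional ℝ F] [FiniteDimensional ℝ E] (hs : IsOpen s)
    (hΦ : ContMDiffOn 𝓘(ℝ, F) 𝓘(ℝ, E) ∞ Φ s)
    {Z : ∀ q, TangentSpace 𝓘(ℝ, E) (Φ q)}
    (hZ : ContMDiffOn 𝓘(ℝ, F) 𝓘(ℝ, E).tangent ∞
      (fun q ↦ (⟨Φ q, Z q⟩ : TangentBundle 𝓘(ℝ, E) M)) s)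
    {p : F} (hp : p ∈ s) (hinj : Function.Injective (mfderiv 𝓘(ℝ, F) 𝓘(ℝ, E) Φ p))
    (hrange : ∀ q ∈ s, ∃ v : F, mfderiv 𝓘(ℝ, F) 𝓘(ℝ, E) Φ q v = Z q) :
    ∃ t ⊆ s, IsOpen t ∧ p ∈ t ∧ ∃ T : F → F, ContDiffOn ℝ ∞ T t ∧
      ∀ q ∈ t, mfderiv 𝓘(ℝ, F) 𝓘(ℝ, E) Φ q (T q) = Z q := by
  have hd : ∀ q ∈ s, MDifferentiableAt 𝓘(ℝ, F) 𝓘(ℝ, E) Φ q := fun q hq ↦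
    (hΦ.contMDiffAt (hs.mem_nhds hq)).mdifferentiableAt (by simp)
  obtain ⟨ho, hξ⟩ := contDiffOn_extChartAt_comp hs hΦ (Φ p)
  set ξ : F → E := fun q ↦ extChartAt 𝓘(ℝ, E) (Φ p) (Φ q) with hξ_def
  set s₁ := s ∩ Φ ⁻¹' (chartAt E (Φ p)).source with hs₁
  have hp₁ : p ∈ s₁ := ⟨hp, mem_chart_source E (Φ p)⟩
  have hAξ : ∀ q ∈ s₁, ∀ v : F, fderiv ℝ ξ q v =
      tangentCoord (Φ p) (Φ q) (mfderiv 𝓘(ℝ, F) 𝓘(ℝ, E) Φ q v) := fun q hq ↦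
    (hasFDerivAt_extChartAt_comp hq.2 (hd q hq.1)).2
  have hker : LinearMap.ker (fderiv ℝ ξ p).toLinearMap = ⊥ := by
    rw [LinearMap.ker_eq_bot']
    intro v hv
    have h1 : fderiv ℝ ξ p v = 0 := hv
    rw [hAξ p hp₁ v, tangentCoord_self] at h1
    exact (injective_iff_map_eq_zero _).1 hinj v h1
  -- A left inverse `L` at `p` is kept fixed. Then `B q = L ∘ dξ_q` is an endomorphism of `F`, the
  -- identity at `p` and so invertible nearby, and `T = B⁻¹ L Z` is smooth because inversion is.
  obtain ⟨L₀, hL₀⟩ := (fderiv ℝ ξ p).toLinearMap.exists_leftInverse_of_injective hker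
  let L : E →L[ℝ] F := LinearMap.toContinuousLinearMap L₀
  have hLp : L.comp (fderiv ℝ ξ p) = ContinuousLinearEquiv.refl ℝ F := by
    ext v
    exact DFunLike.congr_fun hL₀ v
  let B : F → F →L[ℝ] F := fun q ↦ L.comp (fderiv ℝ ξ q)
  have hB : ContDiffOn ℝ ∞ B s₁ :=
    contDiffOn_const.clm_comp (hξ.fderiv_of_isOpen ho (by norm_cast))
  let R : Set (F →L[ℝ] F) := range ((↑) : (F ≃L[ℝ] F) → (F →L[ℝ] F))
  have hR : IsOpen R := ContinuousLinearEquiv.isOpen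
  refine ⟨s₁ ∩ B ⁻¹' R, fun q hq ↦ hq.1.1, hB.continuousOn.isOpen_inter_preimage ho hR,
    ⟨hp₁, ⟨ContinuousLinearEquiv.refl ℝ F, hLp.symm⟩⟩,
    fun q ↦ (B q).inverse (L (tangentCoord (Φ p) (Φ q) (Z q))), ?_, ?_⟩
  · intro q hq
    obtain ⟨⟨e, he⟩, hq₁⟩ := And.intro hq.2 hq.1
    have h1 : ContDiffAt ℝ ∞ (fun q ↦ (B q).inverse) q := by
      have h2 : ContDiffAt ℝ ∞ (ContinuousLinearMap.inverse : (F →L[ℝ] F) → F →L[ℝ] F) (B q) := by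
        rw [← he]
        exact contDiffAt_map_inverse e
      exact h2.comp q (hB.contDiffAt (ho.mem_nhds hq₁))
    have h3 : ContDiffAt ℝ ∞ (fun q ↦ L (tangentCoord (Φ p) (Φ q) (Z q))) q :=
      L.contDiff.contDiffAt.comp q
        ((contDiffOn_tangentCoord hZ (Φ p)).contDiffAt (ho.mem_nhds hq₁))
    exact (h1.clm_apply h3).contDiffWithinAt
  · intro q hq
    obtain ⟨⟨e, he⟩, hq₁⟩ := And.intro hq.2 hq.1
    obtain ⟨v, hv⟩ := hrange q hq₁.1
    have h1 : L (tangentCoord (Φ p) (Φ q) (Z q)) = B q v := by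
      rw [← hv, ← hAξ q hq₁ v]
      rfl
    have h2 : (B q).inverse (L (tangentCoord (Φ p) (Φ q) (Z q))) = v := by
      rw [h1, ← he, ContinuousLinearMap.inverse_equiv]
      exact e.symm_apply_apply v
    simp only [h2]
    exact hv

end CoordinateFields

/-! ### Pointwise algebra of the structure equations. -/

section LinearAlgebra

variable {H : Type*} [NormedAddCommGroup H] [InnerProductSpace ℝ H]

/-- A vector orthogonal to three nonzero pairwise orthogonal vectors of a three-dimensional space
vanishes. -/
theorem eq_zero_of_inner_orthogonal_eq_zero (hdim : Module.finrank ℝ H = 3) {a b c r : H}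
    (ha : a ≠ 0) (hb : b ≠ 0) (hc : c ≠ 0) (hab : (inner ℝ a b : ℝ) = 0)
    (hac : (inner ℝ a c : ℝ) = 0) (hbc : (inner ℝ b c : ℝ) = 0) (har : (inner ℝ a r : ℝ) = 0)
    (hbr : (inner ℝ b r : ℝ) = 0) (hcr : (inner ℝ c r : ℝ) = 0) : r = 0 := by
  by_contra hne
  have hfd : FiniteDimensional ℝ H := .of_finrank_pos (by omega)
  have hba := (real_inner_comm a b).trans hab
  have hca := (real_inner_comm a c).trans hac
  have hcb := (real_inner_comm b c).trans hbc
  have hra := (real_inner_comm a r).trans har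
  have hrb := (real_inner_comm b r).trans hbr
  have hrc := (real_inner_comm c r).trans hcr
  have hli : LinearIndependent ℝ ![a, b, c, r] := by
    refine linearIndependent_of_ne_zero_of_inner_eq_zero (𝕜 := ℝ) ?_ ?_
    · intro i
      fin_cases i <;> simpa
    · intro i j hij
      fin_cases i <;> fin_cases j <;> first | exact absurd rfl hij | assumption
  have := hli.fintype_card_le_finrank
  rw [hdim] at this
  simp at this

/-- Pointwise form of the structure equations of a constant angle surface. The vectors `Dᵢ` are the
covariant derivatives in the `i`-th coordinate direction. -/
structure FrameRelations (X₀ X₁ U V D₀X₀ D₁X₀ D₀U D₁U : H) (f c s : ℝ) : Prop where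
  axis_eq : V = s • X₀ + c • U
  deriv_zero : s • D₀X₀ + c • D₀U = f • (X₀ - (inner ℝ V X₀ : ℝ) • V)
  deriv_one : s • D₁X₀ + c • D₁U = f • (X₁ - (inner ℝ V X₁ : ℝ) • V)
  inner_X₀_X₀ : (inner ℝ X₀ X₀ : ℝ) = 1
  inner_U_U : (inner ℝ U U : ℝ) = 1
  inner_U_X₀ : (inner ℝ U X₀ : ℝ) = 0
  inner_U_X₁ : (inner ℝ U X₁ : ℝ) = 0
  inner_D₁X₀_X₀ : (inner ℝ D₁X₀ X₀ : ℝ) = 0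
  inner_D₁U_U : (inner ℝ D₁U U : ℝ) = 0
  inner_D₀U_X₁ : (inner ℝ D₀U X₁ : ℝ) + inner ℝ U D₁X₀ = 0
  inner_D₁U_X₀ : (inner ℝ D₁U X₀ : ℝ) + inner ℝ U D₁X₀ = 0
  sin_ne_zero : s ≠ 0
  sq_add_sq : s ^ 2 + c ^ 2 = 1

namespace FrameRelations

variable {X₀ X₁ U V D₀X₀ D₁X₀ D₀U D₁U : H} {f c s : ℝ}

theorem inner_V_X₀ (h : FrameRelations X₀ X₁ U V D₀X₀ D₁X₀ D₀U D₁U f c s) :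
    (inner ℝ V X₀ : ℝ) = s := by
  rw [h.axis_eq, inner_add_left, real_inner_smul_left, real_inner_smul_left, h.inner_X₀_X₀,
    h.inner_U_X₀]
  ring

theorem inner_V_X₁ (h : FrameRelations X₀ X₁ U V D₀X₀ D₁X₀ D₀U D₁U f c s) :
    (inner ℝ V X₁ : ℝ) = s * inner ℝ X₀ X₁ := by
  rw [h.axis_eq, inner_add_left, real_inner_smul_left, real_inner_smul_left, h.inner_U_X₁]
  ring

theorem inner_V_U (h : FrameRelations X₀ X₁ U V D₀X₀ D₁X₀ D₀U D₁U f c s) :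
    (inner ℝ V U : ℝ) = c := by
  rw [h.axis_eq, inner_add_left, real_inner_smul_left, real_inner_smul_left, h.inner_U_U,
    real_inner_comm, h.inner_U_X₀]
  ring

/-- This is the `U` component of `deriv_one`: `D₁U` and `X₁` contribute nothing, and the normal part
of `D₁X₀` is `-⟨D₁U, X₀⟩`. -/
theorem inner_D₁U_X₀_eq (h : FrameRelations X₀ X₁ U V D₀X₀ D₁X₀ D₀U D₁U f c s) :
    (inner ℝ D₁U X₀ : ℝ) = f * c * inner ℝ X₀ X₁ := by
  have h1 := congrArg (fun w ↦ (inner ℝ w U : ℝ)) h.deriv_one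
  simp only [inner_add_left, inner_sub_left, real_inner_smul_left, h.inner_D₁U_U, h.inner_V_U,
    h.inner_V_X₁] at h1
  rw [real_inner_comm U X₁, h.inner_U_X₁, real_inner_comm U D₁X₀] at h1
  have h2 := h.inner_D₁U_X₀
  have h3 : s * (inner ℝ D₁U X₀ - f * c * inner ℝ X₀ X₁ : ℝ) = 0 := by
    linear_combination s * h2 - h1
  have := (mul_eq_zero.1 h3).resolve_left h.sin_ne_zero
  linarith

/-- The mixed coefficient of the first fundamental form is constant in the first variable. -/
theorem deriv_inner_X₀_X₁ (h : FrameRelations X₀ X₁ U V D₀X₀ D₁X₀ D₀U D₁U f c s) :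
    (inner ℝ D₀X₀ X₁ : ℝ) + inner ℝ X₀ D₁X₀ = 0 := by
  have h1 := congrArg (fun w ↦ (inner ℝ w X₁ : ℝ)) h.deriv_zero
  simp only [inner_add_left, inner_sub_left, real_inner_smul_left, h.inner_V_X₀,
    h.inner_V_X₁] at h1
  -- Symmetry of the second fundamental form: `⟨D₀U, X₁⟩` and `⟨D₁U, X₀⟩` both equal `-⟨U, D₁X₀⟩`.
  have h2 : (inner ℝ D₀U X₁ : ℝ) = f * c * inner ℝ X₀ X₁ := by
    linarith [h.inner_D₀U_X₁, h.inner_D₁U_X₀, h.inner_D₁U_X₀_eq]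
  rw [real_inner_comm D₁X₀ X₀, h.inner_D₁X₀_X₀, add_zero]
  rw [h2] at h1
  -- The `X₁` component of `deriv_zero` leaves `f ⟨X₀, X₁⟩ (1 - s² - c²)`.
  have h3 : s * (inner ℝ D₀X₀ X₁ : ℝ) = 0 := by
    linear_combination h1 - f * (inner ℝ X₀ X₁ : ℝ) * h.sq_add_sq
  exact (mul_eq_zero.1 h3).resolve_left h.sin_ne_zero

/-- If the coordinates are orthogonal then the second coordinate direction is principal. -/
theorem neg_D₁U_eq (h : FrameRelations X₀ X₁ U V D₀X₀ D₁X₀ D₀U D₁U f c s)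
    (hdim : Module.finrank ℝ H = 3) (hF : (inner ℝ X₀ X₁ : ℝ) = 0) (hX₁ : X₁ ≠ 0) :
    -D₁U = (-(inner ℝ D₁U X₁ : ℝ) / inner ℝ X₁ X₁) • X₁ := by
  have hG : (inner ℝ X₁ X₁ : ℝ) ≠ 0 := inner_self_ne_zero.2 hX₁
  -- `R` is the part of `D₁U` orthogonal to `X₁`. It is also orthogonal to `X₀` and `U`, hence zero
  -- by dimension.
  set R : H := D₁U - ((inner ℝ D₁U X₁ : ℝ) / inner ℝ X₁ X₁) • X₁ with hR
  have hR0 : (inner ℝ X₀ R : ℝ) = 0 := by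
    rw [hR, inner_sub_right, real_inner_smul_right, real_inner_comm, h.inner_D₁U_X₀_eq, hF]
    ring
  have hR1 : (inner ℝ X₁ R : ℝ) = 0 := by
    rw [hR, inner_sub_right, real_inner_smul_right, real_inner_comm]
    field_simp
    ring
  have hRU : (inner ℝ U R : ℝ) = 0 := by
    rw [hR, inner_sub_right, real_inner_smul_right, real_inner_comm, h.inner_D₁U_U, h.inner_U_X₁]
    ring
  have hRzero : R = 0 := by
    have hX₀ : X₀ ≠ 0 := fun h0 ↦ by
      have := h.inner_X₀_X₀
      rw [h0, inner_zero_left] at this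
      exact zero_ne_one this
    have hU : U ≠ 0 := fun h0 ↦ by
      have := h.inner_U_U
      rw [h0, inner_zero_left] at this
      exact zero_ne_one this
    exact eq_zero_of_inner_orthogonal_eq_zero hdim hX₀ hX₁ hU hF
      ((real_inner_comm _ _).trans h.inner_U_X₀) ((real_inner_comm _ _).trans h.inner_U_X₁)
      hR0 hR1 hRU
  have : D₁U = ((inner ℝ D₁U X₁ : ℝ) / inner ℝ X₁ X₁) • X₁ := sub_eq_zero.1 hRzero
  rw [neg_div, neg_smul, ← this]

/-- The `X₁` component of `deriv_one`. The left side is half the `s`-derivative of `⟨X₁, X₁⟩`, and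
the quotient on the right is the principal curvature along `X₁`. -/
theorem inner_D₁X₀_X₁ (h : FrameRelations X₀ X₁ U V D₀X₀ D₁X₀ D₀U D₁U f c s)
    (hF : (inner ℝ X₀ X₁ : ℝ) = 0) (hX₁ : X₁ ≠ 0) :
    (inner ℝ D₁X₀ X₁ : ℝ) =
      (c * (-(inner ℝ D₁U X₁ : ℝ) / inner ℝ X₁ X₁) + f) / s * inner ℝ X₁ X₁ := by
  have hG : (inner ℝ X₁ X₁ : ℝ) ≠ 0 := inner_self_ne_zero.2 hX₁
  have h1 := congrArg (fun w ↦ (inner ℝ w X₁ : ℝ)) h.deriv_one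
  simp only [inner_add_left, inner_sub_left, real_inner_smul_left, h.inner_V_X₁, hF] at h1
  have hs := h.sin_ne_zero
  field_simp
  linear_combination h1

end FrameRelations

end LinearAlgebra

section LinearCombination

variable {E : Type*} [NormedAddCommGroup E] [NormedSpace ℝ E]
  {M : Type*} [TopologicalSpace M] [ChartedSpace E M] [IsManifold 𝓘(ℝ, E) ∞ M]
  {F : Type*} [NormedAddCommGroup F] [NormedSpace ℝ F] {Φ : F → M} {s : Set F}

/-- Linear combinations of smooth fields along a map are smooth. -/
theorem contMDiffOn_smul_add_smul (hs : IsOpen s) {A B : ∀ q, TangentSpace 𝓘(ℝ, E) (Φ q)}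
    (hA : ContMDiffOn 𝓘(ℝ, F) 𝓘(ℝ, E).tangent ∞
      (fun q ↦ (⟨Φ q, A q⟩ : TangentBundle 𝓘(ℝ, E) M)) s)
    (hB : ContMDiffOn 𝓘(ℝ, F) 𝓘(ℝ, E).tangent ∞
      (fun q ↦ (⟨Φ q, B q⟩ : TangentBundle 𝓘(ℝ, E) M)) s) (a b : ℝ) :
    ContMDiffOn 𝓘(ℝ, F) 𝓘(ℝ, E).tangent ∞
      (fun q ↦ (⟨Φ q, a • A q + b • B q⟩ : TangentBundle 𝓘(ℝ, E) M)) s := by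
  intro p hp
  have hA' := contMDiffAt_totalSpace.1 (hA.contMDiffAt (hs.mem_nhds hp))
  have hB' := contMDiffAt_totalSpace.1 (hB.contMDiffAt (hs.mem_nhds hp))
  have h1 : ContDiffAt ℝ ∞ (fun q ↦ tangentCoord (Φ p) (Φ q) (A q)) p :=
    contMDiffAt_iff_contDiffAt.1 hA'.2
  have h2 : ContDiffAt ℝ ∞ (fun q ↦ tangentCoord (Φ p) (Φ q) (B q)) p :=
    contMDiffAt_iff_contDiffAt.1 hB'.2
  have h3 := (h1.const_smul a).add (h2.const_smul b)
  refine ContMDiffAt.contMDiffWithinAt ?_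
  rw [contMDiffAt_totalSpace]
  refine ⟨hA'.1, (contMDiffAt_iff_contDiffAt.2 h3).congr_of_eventuallyEq ?_⟩
  filter_upwards [eventually_mem_chart_source (hA'.1.mdifferentiableAt (by simp))] with q hq
  change tangentCoord (Φ p) (Φ q) (a • A q + b • B q) = _
  rw [tangentCoord_add hq, tangentCoord_smul hq, tangentCoord_smul hq]

end LinearCombination

section TangentPlane

/-- In a three-dimensional space, an injective linear image of the plane is the orthogonal
complement of any nonzero vector orthogonal to it. -/
theorem exists_eq_of_inner_eq_zero {H P : Type*} [NormedAddCommGroup H] [InnerProductSpace ℝ H]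
    [AddCommGroup P] [Module ℝ P] (hH : Module.finrank ℝ H = 3) (hP : Module.finrank ℝ P = 2)
    (A : P →ₗ[ℝ] H) (hA : Function.Injective A) {u z : H} (hu : u ≠ 0)
    (huA : ∀ v, (inner ℝ u (A v) : ℝ) = 0) (huz : (inner ℝ u z : ℝ) = 0) : ∃ v, A v = z := by
  have hfd : FiniteDimensional ℝ H := .of_finrank_pos (by omega)
  have hfact : Fact (Module.finrank ℝ H = 2 + 1) := ⟨hH⟩
  have hle : LinearMap.range A ≤ (ℝ ∙ u)ᗮ := by
    rintro _ ⟨v, rfl⟩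
    exact Submodule.mem_orthogonal_singleton_iff_inner_right.2 (huA v)
  have heq : LinearMap.range A = (ℝ ∙ u)ᗮ :=
    Submodule.eq_of_le_of_finrank_eq hle (by
      rw [LinearMap.finrank_range_of_inj hA, hP, Submodule.finrank_orthogonal_span_singleton (n := 2) hu])
  have hz : z ∈ LinearMap.range A := by
    rw [heq]
    exact Submodule.mem_orthogonal_singleton_iff_inner_right.2 huz
  exact hz

end TangentPlane

/-! ### Charts obtained by changing coordinates. -/

section Charts

variable {G : Type*} [NormedAddCommGroup G] [NormedSpace ℝ G]
  {N : Type*} [TopologicalSpace N] [ChartedSpace G N]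

theorem mem_contDiffGroupoid {Ψ : OpenPartialHomeomorph G G} (h : ContDiffOn ℝ ∞ Ψ Ψ.source)
    (hsymm : ContDiffOn ℝ ∞ Ψ.symm Ψ.target) : Ψ ∈ contDiffGroupoid ∞ 𝓘(ℝ, G) := by
  rw [contDiffGroupoid, mem_groupoid_of_pregroupoid]
  simpa [contDiffPregroupoid] using ⟨h, hsymm⟩

/-- Composing a chart with a smooth change of coordinates gives a chart. -/
theorem trans_mem_maximalAtlas [IsManifold 𝓘(ℝ, G) ∞ N] {κ : OpenPartialHomeomorph N G}
    (hκ : κ ∈ atlas G N) {Ψ : OpenPartialHomeomorph G G}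
    (hΨ : Ψ ∈ contDiffGroupoid ∞ 𝓘(ℝ, G)) :
    κ.trans Ψ ∈ IsManifold.maximalAtlas 𝓘(ℝ, G) ∞ N := by
  intro e' he'
  constructor
  · rw [OpenPartialHomeomorph.trans_symm_eq_symm_trans_symm, OpenPartialHomeomorph.trans_assoc]
    exact (contDiffGroupoid ∞ 𝓘(ℝ, G)).trans ((contDiffGroupoid ∞ 𝓘(ℝ, G)).symm hΨ)
      (HasGroupoid.compatible hκ he')
  · rw [← OpenPartialHomeomorph.trans_assoc]
    exact (contDiffGroupoid ∞ 𝓘(ℝ, G)).trans (HasGroupoid.compatible he' hκ) hΨ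

end Charts

section AdaptedChart

variable {M : Type*} [TopologicalSpace M] [ChartedSpace (EuclideanSpace ℝ (Fin 3)) M]

theorem finrank_tangentSpace (x : M) : Module.finrank ℝ (TangentSpace (𝓡 3) x) = 3 :=
  finrank_euclideanSpace_fin (𝕜 := ℝ) (n := 3)

variable [IsManifold (𝓡 3) ∞ M] [RiemannianBundle (fun x : M ↦ TangentSpace (𝓡 3) x)]
  {N : Type*} [TopologicalSpace N] [ChartedSpace (EuclideanSpace ℝ (Fin 2)) N]

/-- A vector orthogonal to the normal is tangent to the surface. -/
theorem IsImmersedSurface.exists_mfderiv_eq {φ : N → M} {U : ∀ p, TangentSpace (𝓡 3) (φ p)}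
    (hφ : IsImmersedSurface φ U) (p : N) {z : TangentSpace (𝓡 3) (φ p)}
    (hz : (inner ℝ (U p) z : ℝ) = 0) :
    ∃ v : TangentSpace (𝓡 2) p, mfderiv (𝓡 2) (𝓡 3) φ p v = z := by
  have hU : U p ≠ 0 := by
    intro h
    have := hφ.norm_normal p
    rw [h, norm_zero] at this
    exact zero_ne_one this
  exact exists_eq_of_inner_eq_zero (finrank_tangentSpace (φ p))
    (finrank_euclideanSpace_fin (𝕜 := ℝ) (n := 2)) (mfderiv (𝓡 2) (𝓡 3) φ p).toLinearMap
    (hφ.injective_mfderiv p) hU (hφ.inner_normal p) hz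

theorem exists_transversal (a : EuclideanSpace ℝ (Fin 2)) (ha : a ≠ 0) :
    ∃ w : EuclideanSpace ℝ (Fin 2), ∀ x y : ℝ, x • a + y • w = 0 → x = 0 ∧ y = 0 := by
  -- The witness is `a` turned by a right angle.
  refine ⟨!₂[-a 1, a 0], fun x y h ↦ ?_⟩
  have h0 := congrArg (fun v : EuclideanSpace ℝ (Fin 2) ↦ v 0) h
  have h1 := congrArg (fun v : EuclideanSpace ℝ (Fin 2) ↦ v 1) h
  simp at h0 h1
  have hpos : a 0 ^ 2 + a 1 ^ 2 ≠ 0 := by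
    intro h2
    apply ha
    ext i
    fin_cases i
    · simp only [Fin.zero_eta, PiLp.zero_apply]
      nlinarith [sq_nonneg (a 0), sq_nonneg (a 1)]
    · simp only [Fin.mk_one, PiLp.zero_apply]
      nlinarith [sq_nonneg (a 0), sq_nonneg (a 1)]
  constructor
  · refine (mul_eq_zero.1 (?_ : x * (a 0 ^ 2 + a 1 ^ 2) = 0)).resolve_right hpos
    linear_combination a 0 * h0 + a 1 * h1
  · refine (mul_eq_zero.1 (?_ : y * (a 0 ^ 2 + a 1 ^ 2) = 0)).resolve_right hpos
    linear_combination a 0 * h1 - a 1 * h0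

end AdaptedChart

/-! ### Coordinates adapted to the tangential part of the axis. -/

section AdaptedCoordinates

variable {M : Type*} [TopologicalSpace M] [ChartedSpace (EuclideanSpace ℝ (Fin 3)) M]
  [IsManifold (𝓡 3) ∞ M] [RiemannianBundle (fun x : M ↦ TangentSpace (𝓡 3) x)]
  [IsContMDiffRiemannianBundle (𝓡 3) ∞ (EuclideanSpace ℝ (Fin 3))
    (fun x : M ↦ TangentSpace (𝓡 3) x)]
  {N : Type*} [TopologicalSpace N] [ChartedSpace (EuclideanSpace ℝ (Fin 2)) N]
  [IsManifold (𝓡 2) ∞ N]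

/-- Around every point of a constant angle surface there is a chart, defined on a square, whose
first coordinate field is the normalized tangential part of the axis and whose coordinate fields
are orthogonal along the axis `s = 0`. -/
theorem exists_adapted_chart {V : ∀ x : M, TangentSpace (𝓡 3) x}
    (hV : ContMDiff (𝓡 3) (𝓡 3).tangent ∞ (fun x ↦ (⟨x, V x⟩ : TangentBundle (𝓡 3) M)))
    (hVunit : ∀ x, ‖V x‖ = 1) {φ : N → M} {U : ∀ p, TangentSpace (𝓡 3) (φ p)}
    (hφ : IsImmersedSurface φ U) {c s : ℝ} (hs : s ≠ 0) (hsc : s ^ 2 + c ^ 2 = 1)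
    (hUV : ∀ p, (inner ℝ (U p) (V (φ p)) : ℝ) = c) (p : N) :
    ∃ e ∈ IsManifold.maximalAtlas (𝓡 2) ∞ N, p ∈ e.source ∧ ∃ r > 0, e.target = openSquare r ∧
      (∀ z ∈ openSquare r,
        mfderiv (𝓡 2) (𝓡 3) (fun w ↦ φ (e.symm w)) z (EuclideanSpace.single 0 (1 : ℝ)) =
          s⁻¹ • V (φ (e.symm z)) + (-(s⁻¹ * c)) • U (e.symm z)) ∧
      ∀ z ∈ openSquare r, z 0 = 0 →
        (inner ℝ
          (mfderiv (𝓡 2) (𝓡 3) (fun w ↦ φ (e.symm w)) z (EuclideanSpace.single 0 (1 : ℝ)))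
          (mfderiv (𝓡 2) (𝓡 3) (fun w ↦ φ (e.symm w)) z (EuclideanSpace.single 1 (1 : ℝ))) : ℝ)
          = 0 := by
  let κ := chartAt (EuclideanSpace ℝ (Fin 2)) p
  have hκ : ContMDiffOn (𝓡 2) (𝓡 2) ∞ κ.symm κ.target := contMDiffOn_chart_symm
  let Φ : EuclideanSpace ℝ (Fin 2) → M := fun y ↦ φ (κ.symm y)
  have hΦ : ContMDiffOn (𝓡 2) (𝓡 3) ∞ Φ κ.target := hφ.contMDiff.comp_contMDiffOn hκ
  -- `Z = (V - c U) / s`; it is a unit vector because `|V - c U|² = 1 - c² = s²`.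
  let Z : ∀ y, TangentSpace (𝓡 3) (Φ y) := fun y ↦
    s⁻¹ • V (Φ y) + (-(s⁻¹ * c)) • U (κ.symm y)
  have hZ : ContMDiffOn (𝓡 2) (𝓡 3).tangent ∞
      (fun y ↦ (⟨Φ y, Z y⟩ : TangentBundle (𝓡 3) M)) κ.target :=
    contMDiffOn_smul_add_smul κ.open_target (A := fun y ↦ V (Φ y)) (B := fun y ↦ U (κ.symm y))
      (hV.comp_contMDiffOn hΦ) (hφ.contMDiff_normal.comp_contMDiffOn hκ) s⁻¹ (-(s⁻¹ * c))
  have hUU : ∀ q, (inner ℝ (U q) (U q) : ℝ) = 1 := fun q ↦ by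
    rw [real_inner_self_eq_norm_sq, hφ.norm_normal, one_pow]
  have hUZ : ∀ y, (inner ℝ (U (κ.symm y)) (Z y) : ℝ) = 0 := fun y ↦ by
    simp only [Z, inner_add_right, real_inner_smul_right]
    rw [hUV, hUU]
    ring
  have hZZ : ∀ y, (inner ℝ (Z y) (Z y) : ℝ) = 1 := fun y ↦ by
    have h1 : (inner ℝ (V (Φ y)) (V (Φ y)) : ℝ) = 1 := by
      rw [real_inner_self_eq_norm_sq, hVunit, one_pow]
    have h2 : (inner ℝ (V (Φ y)) (U (κ.symm y)) : ℝ) = c := by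
      rw [real_inner_comm]
      exact hUV _
    have h3 : (inner ℝ (U (κ.symm y)) (V (Φ y)) : ℝ) = c := hUV _
    have h4 := hUU (κ.symm y)
    simp only [Z, inner_add_right, inner_add_left, real_inner_smul_right, real_inner_smul_left]
    rw [h1, h2, h3, h4]
    field_simp
    linear_combination -hsc
  have hκd : ∀ y ∈ κ.target, MDifferentiableAt (𝓡 2) (𝓡 2) κ.symm y := fun y hy ↦
    (hκ.contMDiffAt (κ.open_target.mem_nhds hy)).mdifferentiableAt (by simp)
  have hΦd : ∀ y ∈ κ.target, MDifferentiableAt (𝓡 2) (𝓡 3) Φ y := fun y hy ↦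
    (hΦ.contMDiffAt (κ.open_target.mem_nhds hy)).mdifferentiableAt (by simp)
  have hφd : ∀ q, MDifferentiableAt (𝓡 2) (𝓡 3) φ q := fun q ↦
    hφ.contMDiff.contMDiffAt.mdifferentiableAt (by simp)
  have hchain : ∀ y ∈ κ.target, mfderiv (𝓡 2) (𝓡 3) Φ y =
      (mfderiv (𝓡 2) (𝓡 3) φ (κ.symm y)).comp (mfderiv (𝓡 2) (𝓡 2) κ.symm y) := fun y hy ↦
    mfderiv_comp y (hφd _) (hκd y hy)
  have hbij : ∀ y ∈ κ.target, Function.Bijective (mfderiv (𝓡 2) (𝓡 2) κ.symm y) := fun y hy ↦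
    ((mdifferentiable_chart (I := 𝓡 2) p).symm).mfderiv_bijective hy
  have hinj : ∀ y ∈ κ.target, Function.Injective (mfderiv (𝓡 2) (𝓡 3) Φ y) := fun y hy ↦ by
    rw [hchain y hy]
    exact (hφ.injective_mfderiv _).comp (hbij y hy).1
  have hrange : ∀ y ∈ κ.target, ∃ v : EuclideanSpace ℝ (Fin 2),
      mfderiv (𝓡 2) (𝓡 3) Φ y v = Z y := fun y hy ↦ by
    obtain ⟨v, hv⟩ := hφ.exists_mfderiv_eq (κ.symm y) (hUZ y)
    obtain ⟨w, hw⟩ := (hbij y hy).2 v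
    refine ⟨w, ?_⟩
    rw [hchain y hy, ← hv, ← hw]
    rfl
  have hp : κ p ∈ κ.target := κ.map_source (mem_chart_source _ p)
  obtain ⟨t, hts, hto, hpt, T, hT, hTZ⟩ := exists_contDiffOn_lift κ.open_target hΦ hZ hp
    (hinj _ hp) hrange
  have hT0 : T (κ p) ≠ 0 := by
    intro h0
    have h1 := hTZ _ hpt
    have h2 := hZZ (κ p)
    rw [← h1, h0] at h2
    have h3 : mfderiv (𝓡 2) (𝓡 3) Φ (κ p) (0 : EuclideanSpace ℝ (Fin 2)) = 0 := map_zero _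
    rw [h3, inner_zero_left] at h2
    exact zero_ne_one h2
  obtain ⟨w, hw⟩ := exists_transversal _ hT0
  -- A Gram–Schmidt step: subtracting `k T` from the constant field `w` makes it orthogonal to the
  -- unit field `T` in the induced metric, and keeps it independent of `T` at the base point.
  let k : EuclideanSpace ℝ (Fin 2) → ℝ := fun y ↦ inner ℝ (Z y) (mfderiv (𝓡 2) (𝓡 3) Φ y w)
  have hk : ContDiffOn ℝ ∞ k κ.target := by
    rw [← contMDiffOn_iff_contDiffOn]
    exact ContMDiffOn.inner_bundle (E := fun x : M ↦ TangentSpace (𝓡 3) x) (b := Φ)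
      hZ (contMDiffOn_mfderiv_apply κ.open_target hΦ w)
  let W : EuclideanSpace ℝ (Fin 2) → EuclideanSpace ℝ (Fin 2) := fun y ↦ w - k y • T y
  have hW : ContDiffOn ℝ ∞ W t := contDiffOn_const.sub ((hk.mono hts).smul hT)
  have hTW : ∀ y ∈ t, (inner ℝ (mfderiv (𝓡 2) (𝓡 3) Φ y (T y))
      (mfderiv (𝓡 2) (𝓡 3) Φ y (W y)) : ℝ) = 0 := by
    intro y hy
    have h1 : mfderiv (𝓡 2) (𝓡 3) Φ y (W y) =
        mfderiv (𝓡 2) (𝓡 3) Φ y w - k y • mfderiv (𝓡 2) (𝓡 3) Φ y (T y) :=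
      ((mfderiv (𝓡 2) (𝓡 3) Φ y).map_sub w (k y • T y)).trans
        (congrArg (fun b ↦ mfderiv (𝓡 2) (𝓡 3) Φ y w - b)
          ((mfderiv (𝓡 2) (𝓡 3) Φ y).map_smul (k y) (T y)))
    rw [h1, hTZ y hy, inner_sub_right, real_inner_smul_right, hZZ, mul_one]
    exact sub_self _
  have hli : ∀ a b : ℝ, a • T (κ p) + b • W (κ p) = 0 → a = 0 ∧ b = 0 := by
    intro a b hab
    have h1 : (a - b * k (κ p)) • T (κ p) + b • w = 0 := by
      rw [← hab]
      simp only [W, smul_sub, sub_smul, mul_smul]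
      abel
    obtain ⟨h2, h3⟩ := hw _ _ h1
    rw [h3, zero_mul, sub_zero] at h2
    exact ⟨h2, h3⟩
  obtain ⟨r, hr, Ψ, hΨs, hΨ0, hΨt, hΨ, hΨ', hΨT, hΨW⟩ := exists_flowBox hto hT hW hpt hli
  have hmem : ∀ z ∈ openSquare r, Ψ z ∈ t := fun z hz ↦ hΨt (Ψ.map_source (hΨs ▸ hz))
  have h0 : (0 : EuclideanSpace ℝ (Fin 2)) ∈ openSquare r := by
    simp [openSquare, hr]
  have hΨd : ∀ z ∈ openSquare r, DifferentiableAt ℝ Ψ z := fun z hz ↦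
    (hΨ.contDiffAt (Ψ.open_source.mem_nhds (hΨs ▸ hz))).differentiableAt (by simp)
  have hder : ∀ z ∈ openSquare r, ∀ a b : EuclideanSpace ℝ (Fin 2), HasLineDerivAt ℝ Ψ b z a →
      mfderiv (𝓡 2) (𝓡 3) (fun w ↦ Φ (Ψ w)) z a = mfderiv (𝓡 2) (𝓡 3) Φ (Ψ z) b := by
    intro z hz a b hab
    have h1 := mfderiv_comp z (hΦd (Ψ z) (hts (hmem z hz)))
      (mdifferentiableAt_iff_differentiableAt.2 (hΨd z hz))
    have h2 : fderiv ℝ Ψ z a = b := ((hΨd z hz).hasFDerivAt.hasLineDerivAt a).unique hab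
    have h3 : mfderiv (𝓡 2) (𝓡 2) Ψ z a = b :=
      (DFunLike.congr_fun mfderiv_eq_fderiv a).trans h2
    exact (DFunLike.congr_fun h1 a).trans (congrArg (mfderiv (𝓡 2) (𝓡 3) Φ (Ψ z)) h3)
  refine ⟨κ.trans Ψ.symm, trans_mem_maximalAtlas (chart_mem_atlas _ p)
    (mem_contDiffGroupoid hΨ' hΨ), ?_, r, hr, ?_, ?_, ?_⟩
  · refine ⟨mem_chart_source _ p, ?_⟩
    change κ p ∈ Ψ.target
    rw [← hΨ0]
    exact Ψ.map_source (hΨs ▸ h0)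
  · rw [OpenPartialHomeomorph.trans_target]
    change Ψ.source ∩ Ψ ⁻¹' κ.target = openSquare r
    rw [hΨs]
    exact inter_eq_left.2 fun z hz ↦ hts (hmem z hz)
  · intro z hz
    exact (hder z hz _ _ (hΨT z hz)).trans (hTZ _ (hmem z hz))
  · intro z hz hz0
    have h1 := hder z hz _ _ (hΨT z hz)
    have h2 := hder z hz _ _ (hΨW z hz hz0)
    exact (congrArg₂ (fun a b : TangentSpace (𝓡 3) (Φ (Ψ z)) ↦ (inner ℝ a b : ℝ)) h1 h2).trans
      (hTW _ (hmem z hz))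

end AdaptedCoordinates

/-! ### Integration along the first coordinate lines. -/

section Square

/-- The line through `z` in the first direction meets the square in an interval, on which `F` is
constant. The parameter `-z 0` lies in it and gives a point with first coordinate zero. -/
theorem eq_zero_of_hasLineDerivAt_zero {r : ℝ} {F : EuclideanSpace ℝ (Fin 2) → ℝ}
    (hd : ∀ z ∈ openSquare r, HasLineDerivAt ℝ F 0 z (EuclideanSpace.single 0 (1 : ℝ)))
    (h0 : ∀ z ∈ openSquare r, z 0 = 0 → F z = 0) :
    ∀ z ∈ openSquare r, F z = 0 := by
  intro z hz
  let ℓ : ℝ → EuclideanSpace ℝ (Fin 2) := fun t ↦ z + t • EuclideanSpace.single 0 (1 : ℝ)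
  have hℓ : ∀ t, ℓ t ∈ openSquare r ↔ t ∈ Ioo (-r - z 0) (r - z 0) := by
    intro t
    simp only [openSquare, mem_ofPred_eq, ℓ, PiLp.add_apply, PiLp.smul_apply,
      PiLp.single_apply, smul_eq_mul, mem_Ioo]
    simp only [if_true, mul_one, one_ne_zero, if_false, mul_zero, add_zero, abs_lt]
    have := abs_lt.1 hz.2
    constructor
    · rintro ⟨⟨h1, h2⟩, -⟩
      constructor <;> linarith
    · rintro ⟨h1, h2⟩
      exact ⟨⟨by linarith, by linarith⟩, this⟩
  have hderiv : ∀ t ∈ Ioo (-r - z 0) (r - z 0), HasDerivAt (fun t ↦ F (ℓ t)) 0 t := by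
    intro t ht
    have h1 : HasDerivAt (fun τ : ℝ ↦ F (ℓ t + τ • EuclideanSpace.single 0 (1 : ℝ))) 0 0 :=
      hd _ ((hℓ t).2 ht)
    have h2 : HasDerivAt (fun τ : ℝ ↦ τ - t) 1 t := (hasDerivAt_id t).sub_const t
    have h3 := HasDerivAt.scomp_of_eq (x := t) (h := fun τ : ℝ ↦ τ - t) h1 h2 (by simp)
    rw [smul_zero] at h3
    refine h3.congr_of_eventuallyEq (Eventually.of_forall fun τ ↦ ?_)
    simp only [ℓ, Function.comp_apply]
    congr 1
    rw [add_assoc, ← add_smul]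
    congr 2
    ring
  have hz0 := abs_lt.1 hz.1
  have ha : (0 : ℝ) ∈ Ioo (-r - z 0) (r - z 0) := ⟨by linarith, by linarith⟩
  have hb : -z 0 ∈ Ioo (-r - z 0) (r - z 0) := ⟨by linarith, by linarith⟩
  have hconst := isOpen_Ioo.is_const_of_deriv_eq_zero isPreconnected_Ioo
    (fun t ht ↦ (hderiv t ht).differentiableAt.differentiableWithinAt)
    (fun t ht ↦ (hderiv t ht).deriv) ha hb
  have h1 : F (ℓ 0) = F z := by simp [ℓ]
  rw [← h1, hconst]
  exact h0 _ ((hℓ _).2 hb) (by simp [ℓ])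

theorem hasLineDerivAt_log_sqrt {G : EuclideanSpace ℝ (Fin 2) → ℝ} {G' : ℝ}
    {z v : EuclideanSpace ℝ (Fin 2)} (hG : HasLineDerivAt ℝ G G' z v) (hpos : ∀ w, 0 ≤ G w)
    (hz : G z ≠ 0) :
    HasLineDerivAt ℝ (fun w ↦ Real.log (Real.sqrt (G w))) (G' / G z / 2) z v := by
  have h1 : (fun w ↦ Real.log (Real.sqrt (G w))) = fun w ↦ Real.log (G w) / 2 :=
    funext fun w ↦ Real.log_sqrt (hpos w)
  rw [h1]
  have h2 := (HasDerivAt.log hG (by simpa using hz)).div_const 2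
  simpa [HasLineDerivAt] using h2

end Square

/-! ### Structure equations of a parametrized constant angle surface. -/

section ParametrizedSurface

variable {M : Type*} [TopologicalSpace M] [ChartedSpace (EuclideanSpace ℝ (Fin 3)) M]
  [IsManifold (𝓡 3) ∞ M]

/-- The coordinate vector fields along a parametrized surface. -/
def coordField (Φ : EuclideanSpace ℝ (Fin 2) → M) (i : Fin 2) (z : EuclideanSpace ℝ (Fin 2)) :
    TangentSpace (𝓡 3) (Φ z) :=
  mfderiv (𝓡 2) (𝓡 3) Φ z (EuclideanSpace.single i (1 : ℝ))

variable {Φ : EuclideanSpace ℝ (Fin 2) → M} {Q : Set (EuclideanSpace ℝ (Fin 2))}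

theorem contMDiffOn_coordField (hQ : IsOpen Q) (hΦ : ContMDiffOn (𝓡 2) (𝓡 3) ∞ Φ Q) (i : Fin 2) :
    ContMDiffOn (𝓡 2) (𝓡 3).tangent ∞
      (fun z ↦ (⟨Φ z, coordField Φ i z⟩ : TangentBundle (𝓡 3) M)) Q :=
  contMDiffOn_mfderiv_apply hQ hΦ _

variable [RiemannianBundle (fun x : M ↦ TangentSpace (𝓡 3) x)]

/-- The covariant derivative of a field along a parametrized surface in the `i`-th coordinate
direction. -/
def covDerivCoord (Φ : EuclideanSpace ℝ (Fin 2) → M) (Z : ∀ z, TangentSpace (𝓡 3) (Φ z))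
    (i : Fin 2) (z : EuclideanSpace ℝ (Fin 2)) : TangentSpace (𝓡 3) (Φ z) :=
  covDerivAlong (F := EuclideanSpace ℝ (Fin 2)) Φ Z z (EuclideanSpace.single i (1 : ℝ))

theorem IsAntiTorqued.covDeriv_eq {V : ∀ x : M, TangentSpace (𝓡 3) x} {f : M → ℝ}
    (hV : IsAntiTorqued V f) (x : M) (v : TangentSpace (𝓡 3) x) :
    covDeriv V x v = f x • (v - (inner ℝ (V x) v : ℝ) • V x) := by
  rw [IsTorseForming.covDeriv_eq hV x v, smul_sub, smul_smul, sub_eq_add_neg, ← neg_smul]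
  congr 2
  simp

theorem IsAntiTorqued.covDerivCoord_eq {V : ∀ x : M, TangentSpace (𝓡 3) x} {f : M → ℝ}
    (hV : IsAntiTorqued V f) {z : EuclideanSpace ℝ (Fin 2)}
    (hΦ : MDifferentiableAt (𝓡 2) (𝓡 3) Φ z) (i : Fin 2) :
    covDerivCoord Φ (fun w ↦ V (Φ w)) i z =
      f (Φ z) • (coordField Φ i z - (inner ℝ (V (Φ z)) (coordField Φ i z) : ℝ) • V (Φ z)) := by
  rw [← hV.covDeriv_eq]
  exact covDerivAlong_comp (φ := fun x : M ↦ x) (Z := V) (h := Φ)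
    (hV.contMDiff_field.contMDiffAt.mdifferentiableAt (by simp)) hΦ _

/-- The coordinate lines of a parametrized surface are geodesics if the corresponding coordinate
field is a constant multiple of a unit anti-torqued field. -/
theorem isGeodesicOn_coordLine (hQ : IsOpen Q) (hΦ : ContMDiffOn (𝓡 2) (𝓡 3) ∞ Φ Q)
    {V : ∀ x : M, TangentSpace (𝓡 3) x} {f : M → ℝ} (hV : IsAntiTorqued V f)
    (hVunit : ∀ x, ‖V x‖ = 1) {k : ℝ} (hX₀ : ∀ z ∈ Q, coordField Φ 0 z = k • V (Φ z))
    (y : EuclideanSpace ℝ (Fin 2)) :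
    IsGeodesicOn (E := EuclideanSpace ℝ (Fin 3))
      (fun τ ↦ Φ (y + τ • EuclideanSpace.single 0 (1 : ℝ)))
      {τ | y + τ • EuclideanSpace.single 0 (1 : ℝ) ∈ Q} := by
  let ℓ : ℝ → EuclideanSpace ℝ (Fin 2) := fun τ ↦ y + τ • EuclideanSpace.single 0 (1 : ℝ)
  have hℓ : ContDiff ℝ ∞ ℓ := contDiff_const.add (contDiff_id.smul contDiff_const)
  have hℓd : ∀ τ, HasFDerivAt ℓ
      ((ContinuousLinearMap.id ℝ ℝ).smulRight (EuclideanSpace.single 0 (1 : ℝ))) τ := fun τ ↦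
    ((hasFDerivAt_id τ).smul_const (EuclideanSpace.single (0 : Fin 2) (1 : ℝ))).const_add y
  have hopen : IsOpen (ℓ ⁻¹' Q) := hQ.preimage hℓ.continuous
  have hγ : ContMDiffOn 𝓘(ℝ, ℝ) (𝓡 3) ∞ (fun τ ↦ Φ (ℓ τ)) (ℓ ⁻¹' Q) :=
    hΦ.comp hℓ.contMDiff.contMDiffOn fun τ hτ ↦ hτ
  have hvel : ∀ τ ∈ ℓ ⁻¹' Q, mfderiv 𝓘(ℝ, ℝ) (𝓡 3) (fun τ ↦ Φ (ℓ τ)) τ (1 : ℝ) =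
      k • V (Φ (ℓ τ)) := by
    intro τ hτ
    rw [← hX₀ _ hτ]
    have h1 := mfderiv_comp τ ((hΦ.contMDiffAt (hQ.mem_nhds hτ)).mdifferentiableAt (by simp))
      (hℓd τ).differentiableAt.mdifferentiableAt
    have h2 : mfderiv 𝓘(ℝ, ℝ) (𝓡 2) ℓ τ (1 : ℝ) = EuclideanSpace.single 0 (1 : ℝ) := by
      refine (DFunLike.congr_fun mfderiv_eq_fderiv (1 : ℝ)).trans ?_
      refine (DFunLike.congr_fun (hℓd τ).fderiv (1 : ℝ)).trans ?_
      exact one_smul ℝ _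
    exact (DFunLike.congr_fun h1 (1 : ℝ)).trans (congrArg (mfderiv (𝓡 2) (𝓡 3) Φ (ℓ τ)) h2)
  refine ⟨hγ, fun τ hτ ↦ ?_⟩
  have hγd : MDifferentiableAt 𝓘(ℝ, ℝ) (𝓡 3) (fun τ ↦ Φ (ℓ τ)) τ :=
    (hγ.contMDiffAt (hopen.mem_nhds hτ)).mdifferentiableAt (by simp)
  have hVd := hV.contMDiff_field.contMDiffAt.mdifferentiableAt (x := Φ (ℓ τ)) (by simp)
  have hVγ : MDifferentiableAt 𝓘(ℝ, ℝ) (𝓡 3).tangent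
      (fun τ ↦ (⟨Φ (ℓ τ), V (Φ (ℓ τ))⟩ : TangentBundle (𝓡 3) M)) τ :=
    MDifferentiableAt.comp (g := fun x ↦ (⟨x, V x⟩ : TangentBundle (𝓡 3) M)) τ hVd hγd
  have h1 : covDerivAlong (F := ℝ) (fun τ ↦ Φ (ℓ τ))
      (fun τ ↦ mfderiv 𝓘(ℝ, ℝ) (𝓡 3) (fun τ ↦ Φ (ℓ τ)) τ (1 : ℝ)) τ (1 : ℝ) =
      covDerivAlong (F := ℝ) (fun τ ↦ Φ (ℓ τ)) (fun τ ↦ k • V (Φ (ℓ τ))) τ (1 : ℝ) :=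
    covDerivAlong_congr (by filter_upwards [hopen.mem_nhds hτ] with σ hσ using hvel σ hσ) _
  have h2 : covDerivAlong (F := ℝ) (fun τ ↦ Φ (ℓ τ)) (fun τ ↦ k • V (Φ (ℓ τ))) τ (1 : ℝ) =
      k • covDerivAlong (F := ℝ) (fun τ ↦ Φ (ℓ τ)) (fun τ ↦ V (Φ (ℓ τ))) τ (1 : ℝ) :=
    covDerivAlong_const_smul (Z := fun τ ↦ V (Φ (ℓ τ))) hVγ k _
  have h3 : covDerivAlong (F := ℝ) (fun τ ↦ Φ (ℓ τ)) (fun τ ↦ V (Φ (ℓ τ))) τ (1 : ℝ) =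
      covDeriv V (Φ (ℓ τ)) (mfderiv 𝓘(ℝ, ℝ) (𝓡 3) (fun τ ↦ Φ (ℓ τ)) τ (1 : ℝ)) :=
    covDerivAlong_comp (φ := fun x : M ↦ x) (Z := V) (h := fun τ ↦ Φ (ℓ τ)) hVd hγd _
  -- The direction `V` is killed by the anti-torqued equation, since the projection orthogonal to
  -- the unit vector `V` annihilates it.
  have h4 : covDeriv V (Φ (ℓ τ)) (k • V (Φ (ℓ τ))) = 0 := by
    rw [hV.covDeriv_eq, real_inner_smul_right, real_inner_self_eq_norm_sq, hVunit, one_pow,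
      mul_one, sub_self, smul_zero]
  refine h1.trans (h2.trans ?_)
  rw [h3, hvel τ hτ, h4, smul_zero]

variable [IsContMDiffRiemannianBundle (𝓡 3) ∞ (EuclideanSpace ℝ (Fin 3))
    (fun x : M ↦ TangentSpace (𝓡 3) x)]

theorem covDerivCoord_coordField_symm (hQ : IsOpen Q) (hΦ : ContMDiffOn (𝓡 2) (𝓡 3) ∞ Φ Q)
    {z : EuclideanSpace ℝ (Fin 2)} (hz : z ∈ Q) (i j : Fin 2) :
    covDerivCoord Φ (coordField Φ i) j z = covDerivCoord Φ (coordField Φ j) i z :=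
  covDerivAlong_mfderiv_symm hQ hΦ hz _ _

theorem hasLineDerivAt_inner_covDerivCoord (hQ : IsOpen Q) {Z W : ∀ z, TangentSpace (𝓡 3) (Φ z)}
    (hZ : ContMDiffOn (𝓡 2) (𝓡 3).tangent ∞ (fun z ↦ (⟨Φ z, Z z⟩ : TangentBundle (𝓡 3) M)) Q)
    (hW : ContMDiffOn (𝓡 2) (𝓡 3).tangent ∞ (fun z ↦ (⟨Φ z, W z⟩ : TangentBundle (𝓡 3) M)) Q)
    {z : EuclideanSpace ℝ (Fin 2)} (hz : z ∈ Q) (i : Fin 2) :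
    HasLineDerivAt ℝ (fun w ↦ (inner ℝ (Z w) (W w) : ℝ))
      (inner ℝ (covDerivCoord Φ Z i z) (W z) + inner ℝ (Z z) (covDerivCoord Φ W i z)) z
      (EuclideanSpace.single i (1 : ℝ)) :=
  hasLineDerivAt_inner ((hZ.contMDiffAt (hQ.mem_nhds hz)).mdifferentiableAt (by simp))
    ((hW.contMDiffAt (hQ.mem_nhds hz)).mdifferentiableAt (by simp)) _

theorem inner_covDerivCoord_of_const (hQ : IsOpen Q) {Z W : ∀ z, TangentSpace (𝓡 3) (Φ z)}
    (hZ : ContMDiffOn (𝓡 2) (𝓡 3).tangent ∞ (fun z ↦ (⟨Φ z, Z z⟩ : TangentBundle (𝓡 3) M)) Q)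
    (hW : ContMDiffOn (𝓡 2) (𝓡 3).tangent ∞ (fun z ↦ (⟨Φ z, W z⟩ : TangentBundle (𝓡 3) M)) Q)
    {k : ℝ} (hk : ∀ z ∈ Q, (inner ℝ (Z z) (W z) : ℝ) = k)
    {z : EuclideanSpace ℝ (Fin 2)} (hz : z ∈ Q) (i : Fin 2) :
    (inner ℝ (covDerivCoord Φ Z i z) (W z) + inner ℝ (Z z) (covDerivCoord Φ W i z) : ℝ) = 0 := by
  have h1 := hasLineDerivAt_inner_covDerivCoord hQ hZ hW hz i
  have h2 : (fun w ↦ (inner ℝ (Z w) (W w) : ℝ)) =ᶠ[𝓝 z] fun _ ↦ k := by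
    filter_upwards [hQ.mem_nhds hz] with w hw using hk w hw
  have h3 := (hasFDerivAt_const (𝕜 := ℝ) k z).congr_of_eventuallyEq h2
  exact h1.unique (h3.hasLineDerivAt _)

/-- The structure equations of a constant angle surface, in coordinates whose first coordinate
field is the normalized tangential part of the axis. -/
theorem frameRelations (hQ : IsOpen Q) (hΦ : ContMDiffOn (𝓡 2) (𝓡 3) ∞ Φ Q)
    {U : ∀ z, TangentSpace (𝓡 3) (Φ z)}
    (hU : ContMDiffOn (𝓡 2) (𝓡 3).tangent ∞ (fun z ↦ (⟨Φ z, U z⟩ : TangentBundle (𝓡 3) M)) Q)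
    {V : ∀ x : M, TangentSpace (𝓡 3) x} {f : M → ℝ} (hV : IsAntiTorqued V f)
    (hVunit : ∀ x, ‖V x‖ = 1) (hUU : ∀ z ∈ Q, (inner ℝ (U z) (U z) : ℝ) = 1)
    (hUX : ∀ z ∈ Q, ∀ i, (inner ℝ (U z) (coordField Φ i z) : ℝ) = 0)
    {c s : ℝ} (hs : s ≠ 0) (hsc : s ^ 2 + c ^ 2 = 1)
    (hX₀ : ∀ z ∈ Q, coordField Φ 0 z = s⁻¹ • V (Φ z) + (-(s⁻¹ * c)) • U z)
    {z : EuclideanSpace ℝ (Fin 2)} (hz : z ∈ Q) :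
    FrameRelations (coordField Φ 0 z) (coordField Φ 1 z) (U z) (V (Φ z))
      (covDerivCoord Φ (coordField Φ 0) 0 z) (covDerivCoord Φ (coordField Φ 0) 1 z)
      (covDerivCoord Φ U 0 z) (covDerivCoord Φ U 1 z) (f (Φ z)) c s := by
  have hX := contMDiffOn_coordField hQ hΦ
  have hd : MDifferentiableAt (𝓡 2) (𝓡 3) Φ z :=
    (hΦ.contMDiffAt (hQ.mem_nhds hz)).mdifferentiableAt (by simp)
  have hUd := (hU.contMDiffAt (hQ.mem_nhds hz)).mdifferentiableAt (by simp)
  have hXd := ((hX 0).contMDiffAt (hQ.mem_nhds hz)).mdifferentiableAt (by simp)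
  have haxis : ∀ w ∈ Q, V (Φ w) = s • coordField Φ 0 w + c • U w := by
    intro w hw
    rw [hX₀ w hw, smul_add, smul_smul, smul_smul, mul_inv_cancel₀ hs, one_smul]
    have : s * -(s⁻¹ * c) = -c := by
      field_simp
    rw [this, neg_smul, neg_add_cancel_right]
  have hXX : ∀ w ∈ Q, (inner ℝ (coordField Φ 0 w) (coordField Φ 0 w) : ℝ) = 1 := by
    intro w hw
    have h1 : (inner ℝ (V (Φ w)) (V (Φ w)) : ℝ) = 1 := by
      rw [real_inner_self_eq_norm_sq, hVunit, one_pow]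
    rw [haxis w hw] at h1
    simp only [inner_add_left, inner_add_right, real_inner_smul_left, real_inner_smul_right,
      hUU w hw, hUX w hw 0, real_inner_comm (U w) (coordField Φ 0 w)] at h1
    have h2 : s ^ 2 * ((inner ℝ (coordField Φ 0 w) (coordField Φ 0 w) : ℝ) - 1) = 0 := by
      linear_combination h1 - hsc
    have := (mul_eq_zero.1 h2).resolve_left (pow_ne_zero 2 hs)
    linarith
  have hDV : ∀ i, s • covDerivCoord Φ (coordField Φ 0) i z + c • covDerivCoord Φ U i z =
      f (Φ z) • (coordField Φ i z -
        (inner ℝ (V (Φ z)) (coordField Φ i z) : ℝ) • V (Φ z)) := by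
    intro i
    rw [← hV.covDerivCoord_eq hd i]
    have h1 : covDerivCoord Φ (fun w ↦ V (Φ w)) i z =
        covDerivCoord Φ (fun w ↦ s • coordField Φ 0 w + c • U w) i z :=
      covDerivAlong_congr (by filter_upwards [hQ.mem_nhds hz] with w hw using haxis w hw) _
    -- The second coefficient is `0`: only smoothness of the scalar multiple is wanted.
    have hsX := (contMDiffOn_smul_add_smul hQ (hX 0) (hX 0) s 0).contMDiffAt (hQ.mem_nhds hz)
    have hcU := (contMDiffOn_smul_add_smul hQ hU hU c 0).contMDiffAt (hQ.mem_nhds hz)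
    simp only [zero_smul, add_zero] at hsX hcU
    have h2 : covDerivCoord Φ (fun w ↦ s • coordField Φ 0 w + c • U w) i z =
        covDerivCoord Φ (fun w ↦ s • coordField Φ 0 w) i z +
          covDerivCoord Φ (fun w ↦ c • U w) i z :=
      covDerivAlong_add (hsX.mdifferentiableAt (by simp)) (hcU.mdifferentiableAt (by simp)) _
    have h3 : covDerivCoord Φ (fun w ↦ s • coordField Φ 0 w) i z =
        s • covDerivCoord Φ (coordField Φ 0) i z := covDerivAlong_const_smul hXd s _
    have h4 : covDerivCoord Φ (fun w ↦ c • U w) i z = c • covDerivCoord Φ U i z :=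
      covDerivAlong_const_smul hUd c _
    rw [h1, h2, h3, h4]
  refine ⟨haxis z hz, hDV 0, hDV 1, hXX z hz, hUU z hz, hUX z hz 0, hUX z hz 1, ?_, ?_, ?_, ?_, hs,
    hsc⟩
  · have h := inner_covDerivCoord_of_const hQ (hX 0) (hX 0) hXX hz 1
    rw [real_inner_comm _ (coordField Φ 0 z)] at h
    linarith
  · have h := inner_covDerivCoord_of_const hQ hU hU hUU hz 1
    rw [real_inner_comm _ (U z)] at h
    linarith
  -- Differentiating `⟨U, X₁⟩ = 0` in the first direction produces `D₀X₁`, which torsion-freeness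
  -- turns into `D₁X₀`.
  · have h := inner_covDerivCoord_of_const hQ hU (hX 1) (fun w hw ↦ hUX w hw 1) hz 0
    rwa [covDerivCoord_coordField_symm hQ hΦ hz 1 0] at h
  · exact inner_covDerivCoord_of_const hQ hU (hX 0) (fun w hw ↦ hUX w hw 0) hz 1

end ParametrizedSurface

section CoordinateVectors

variable {M : Type*} [TopologicalSpace M] [ChartedSpace (EuclideanSpace ℝ (Fin 3)) M]
  {N : Type*} [TopologicalSpace N] [ChartedSpace (EuclideanSpace ℝ (Fin 2)) N]

theorem mdifferentiableAt_symm {e : OpenPartialHomeomorph N (EuclideanSpace ℝ (Fin 2))}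
    (he : e ∈ IsManifold.maximalAtlas (𝓡 2) ∞ N) {z : EuclideanSpace ℝ (Fin 2)}
    (hz : z ∈ e.target) : MDifferentiableAt (𝓡 2) (𝓡 2) e.symm z :=
  ((contMDiffOn_symm_of_mem_maximalAtlas he).contMDiffAt
    (e.open_target.mem_nhds hz)).mdifferentiableAt (by simp)

theorem coordVector_ne_zero {e : OpenPartialHomeomorph N (EuclideanSpace ℝ (Fin 2))}
    (he : e ∈ IsManifold.maximalAtlas (𝓡 2) ∞ N) {z : EuclideanSpace ℝ (Fin 2)}
    (hz : z ∈ e.target) (i : Fin 2) : coordVector e i z ≠ 0 := by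
  have hd : e.MDifferentiable (𝓡 2) (𝓡 2) :=
    ⟨(contMDiffOn_of_mem_maximalAtlas he).mdifferentiableOn (by simp),
      (contMDiffOn_symm_of_mem_maximalAtlas he).mdifferentiableOn (by simp)⟩
  intro h0
  have h1 := (hd.symm.mfderiv_bijective hz).1 (h0.trans (map_zero _).symm)
  have h2 := congrArg (fun v : EuclideanSpace ℝ (Fin 2) ↦ v i) h1
  have h3 : (EuclideanSpace.single i (1 : ℝ)) i = (0 : ℝ) := h2
  simp at h3

theorem mfderiv_coordVector {e : OpenPartialHomeomorph N (EuclideanSpace ℝ (Fin 2))}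
    (he : e ∈ IsManifold.maximalAtlas (𝓡 2) ∞ N) {z : EuclideanSpace ℝ (Fin 2)}
    (hz : z ∈ e.target) {φ : N → M} (hφ : ContMDiff (𝓡 2) (𝓡 3) ∞ φ) (i : Fin 2) :
    mfderiv (𝓡 2) (𝓡 3) φ (e.symm z) (coordVector e i z) =
      coordField (fun w ↦ φ (e.symm w)) i z :=
  (DFunLike.congr_fun (mfderiv_comp z (hφ.contMDiffAt.mdifferentiableAt (by simp))
    (mdifferentiableAt_symm he hz)) (EuclideanSpace.single i (1 : ℝ))).symm

end CoordinateVectors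

/-! ### The two cases of the theorem. -/

section ConstantAngleSurface

variable {M : Type*} [TopologicalSpace M] [ChartedSpace (EuclideanSpace ℝ (Fin 3)) M]
  [IsManifold (𝓡 3) ∞ M] [RiemannianBundle (fun x : M ↦ TangentSpace (𝓡 3) x)]
  {N : Type*} [TopologicalSpace N] [ChartedSpace (EuclideanSpace ℝ (Fin 2)) N]

/-- The tangential part of the axis has squared norm `1 - cos² θ = sin² θ`. -/
theorem IsConstantAngle.sin_ne_zero {φ : N → M} {U : ∀ p, TangentSpace (𝓡 3) (φ p)}
    {V : ∀ x : M, TangentSpace (𝓡 3) x} {θ : ℝ} (hθ : IsConstantAngle φ U V θ)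
    (hφ : IsImmersedSurface φ U) (hVunit : ∀ x, ‖V x‖ = 1) (p : N) : Real.sin θ ≠ 0 := by
  intro h0
  apply hθ.tangential_ne_zero p
  have h1 : (inner ℝ (V (φ p)) (U p) : ℝ) = Real.cos θ :=
    (real_inner_comm _ _).trans (hθ.inner_eq p)
  rw [h1, ← norm_eq_zero, ← sq_eq_zero_iff, norm_sub_sq_real, norm_smul, real_inner_smul_right,
    h1, hVunit, hφ.norm_normal, mul_one, Real.norm_eq_abs, sq_abs]
  have h2 := Real.sin_sq_add_cos_sq θ
  rw [h0] at h2
  linarith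

variable [IsManifold (𝓡 2) ∞ N]
  [IsContMDiffRiemannianBundle (𝓡 3) ∞ (EuclideanSpace ℝ (Fin 3))
    (fun x : M ↦ TangentSpace (𝓡 3) x)]

/-- Around each of its points, a constant angle surface with an anti-torqued axis is ruled if the
angle is right, and carries adapted coordinates otherwise. -/
theorem isRuledNear_or_hasAdaptedCoordinatesNear {V : ∀ x : M, TangentSpace (𝓡 3) x} {f : M → ℝ}
    (hV : IsAntiTorqued V f) (hVunit : ∀ x, ‖V x‖ = 1) {φ : N → M}
    {U : ∀ p, TangentSpace (𝓡 3) (φ p)} (hφ : IsImmersedSurface φ U) {θ : ℝ}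
    (hθ : IsConstantAngle φ U V θ) (p : N) :
    (Real.cos θ = 0 ∧ IsRuledNear φ p) ∨
      (Real.cos θ ≠ 0 ∧ HasAdaptedCoordinatesNear φ U f θ p) := by
  have hs := hθ.sin_ne_zero hφ hVunit p
  have hsc := Real.sin_sq_add_cos_sq θ
  obtain ⟨e, he, hp, r, hr, htar, hX₀, hF0⟩ :=
    exists_adapted_chart hV.contMDiff_field hVunit hφ hs hsc hθ.inner_eq p
  set c := Real.cos θ with hc
  set s := Real.sin θ with hs'
  let Φ : EuclideanSpace ℝ (Fin 2) → M := fun w ↦ φ (e.symm w)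
  let UΦ : ∀ z, TangentSpace (𝓡 3) (Φ z) := fun z ↦ U (e.symm z)
  have hQ := isOpen_openSquare r
  have hsymm : ContMDiffOn (𝓡 2) (𝓡 2) ∞ e.symm (openSquare r) :=
    htar ▸ contMDiffOn_symm_of_mem_maximalAtlas he
  have hΦ : ContMDiffOn (𝓡 2) (𝓡 3) ∞ Φ (openSquare r) := hφ.contMDiff.comp_contMDiffOn hsymm
  have hUΦ : ContMDiffOn (𝓡 2) (𝓡 3).tangent ∞
      (fun z ↦ (⟨Φ z, UΦ z⟩ : TangentBundle (𝓡 3) M)) (openSquare r) :=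
    hφ.contMDiff_normal.comp_contMDiffOn hsymm
  have hmem : ∀ z ∈ openSquare r, z ∈ e.target := fun z hz ↦ htar ▸ hz
  have hpush : ∀ z ∈ openSquare r, ∀ i,
      mfderiv (𝓡 2) (𝓡 3) φ (e.symm z) (coordVector e i z) = coordField Φ i z :=
    fun z hz i ↦ mfderiv_coordVector he (hmem z hz) hφ.contMDiff i
  by_cases hc0 : c = 0
  · refine Or.inl ⟨hc0, e, he, hp, fun y _ ↦ ?_⟩
    rw [htar]
    refine isGeodesicOn_coordLine (Φ := Φ) (k := s⁻¹) hQ hΦ hV hVunit (fun z hz ↦ ?_) y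
    refine (hX₀ z hz).trans ?_
    rw [hc0, mul_zero, neg_zero, zero_smul, add_zero]
  refine Or.inr ⟨hc0, e, he, hp, ?_⟩
  have hframe : ∀ z ∈ openSquare r,
      FrameRelations (coordField Φ 0 z) (coordField Φ 1 z) (UΦ z) (V (Φ z))
        (covDerivCoord Φ (coordField Φ 0) 0 z) (covDerivCoord Φ (coordField Φ 0) 1 z)
        (covDerivCoord Φ UΦ 0 z) (covDerivCoord Φ UΦ 1 z) (f (Φ z)) c s := fun z hz ↦
    frameRelations hQ hΦ hUΦ hV hVunit
      (fun w _ ↦ by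
        rw [real_inner_self_eq_norm_sq]
        exact (congrArg (· ^ 2) (hφ.norm_normal (e.symm w))).trans (one_pow 2))
      (fun w hw i ↦ (congrArg (fun x ↦ (inner ℝ (UΦ w) x : ℝ)) (hpush w hw i)).symm.trans
        (hφ.inner_normal _ _)) hs hsc hX₀ hz
  have hX := contMDiffOn_coordField hQ hΦ
  -- The mixed coefficient vanishes where the first coordinate is zero, by the choice of chart, and
  -- the structure equations make its first partial derivative vanish.
  have hF : ∀ z ∈ openSquare r, (inner ℝ (coordField Φ 0 z) (coordField Φ 1 z) : ℝ) = 0 := by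
    refine eq_zero_of_hasLineDerivAt_zero (fun z hz ↦ ?_) hF0
    have h := hasLineDerivAt_inner_covDerivCoord hQ (hX 0) (hX 1) hz 0
    rwa [covDerivCoord_coordField_symm hQ hΦ hz 1 0, (hframe z hz).deriv_inner_X₀_X₁] at h
  have hX₁ : ∀ z ∈ openSquare r, coordField Φ 1 z ≠ 0 := fun z hz h0 ↦
    coordVector_ne_zero he (hmem z hz) 1
      (hφ.injective_mfderiv _ (((hpush z hz 1).trans h0).trans (map_zero _).symm))
  let G : EuclideanSpace ℝ (Fin 2) → ℝ := fun z ↦ inner ℝ (coordField Φ 1 z) (coordField Φ 1 z)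
  have hGne : ∀ z ∈ openSquare r, G z ≠ 0 := fun z hz ↦ inner_self_ne_zero.2 (hX₁ z hz)
  have hGnn : ∀ z, 0 ≤ G z := fun z ↦ real_inner_self_nonneg
  have hG : ContDiffOn ℝ ∞ G (openSquare r) := by
    rw [← contMDiffOn_iff_contDiffOn]
    exact ContMDiffOn.inner_bundle (E := fun x : M ↦ TangentSpace (𝓡 3) x) (b := Φ) (hX 1) (hX 1)
  refine ⟨fun z ↦ √(G z), fun z ↦ -(inner ℝ (covDerivCoord Φ UΦ 1 z) (coordField Φ 1 z) : ℝ) / G z,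
    htar ▸ hG.sqrt hGne, ?_⟩
  rw [htar]
  intro z hz
  have hmetric : ∀ i j, inducedMetric φ (e.symm z) (coordVector e i z) (coordVector e j z) =
      inner ℝ (coordField Φ i z) (coordField Φ j z) := fun i j ↦
    congrArg₂ (fun a b : TangentSpace (𝓡 3) (Φ z) ↦ (inner ℝ a b : ℝ)) (hpush z hz i) (hpush z hz j)
  refine ⟨Real.sqrt_pos.2 ((hGnn z).lt_of_ne' (hGne z hz)),
    (hmetric 0 0).trans (hframe z hz).inner_X₀_X₀, (hmetric 0 1).trans (hF z hz),
    (hmetric 1 1).trans (Real.sq_sqrt (hGnn z)).symm,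
    ⟨coordVector_ne_zero he (hmem z hz) 1, ?_⟩, ?_⟩
  · have h1 : covDerivCoord Φ UΦ 1 z = covDerivAlong φ U (e.symm z) (coordVector e 1 z) :=
      covDerivAlong_comp (φ := φ) (Z := U) (h := e.symm)
        (hφ.contMDiff_normal.contMDiffAt.mdifferentiableAt (by simp))
        (mdifferentiableAt_symm he (hmem z hz)) _
    have h2 := (hframe z hz).neg_D₁U_eq (finrank_tangentSpace (Φ z)) (hF z hz) (hX₁ z hz)
    exact (congrArg (fun a ↦ -a) h1.symm).trans
      (h2.trans (congrArg (fun a : TangentSpace (𝓡 3) (Φ z) ↦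
        (-(inner ℝ (covDerivCoord Φ UΦ 1 z) (coordField Φ 1 z) : ℝ) / G z) • a)
        (hpush z hz 1).symm))
  -- Here `(log √G)_s = G_s / (2 G)`, and `G_s = 2 ⟨D₀X₁, X₁⟩ = 2 ⟨D₁X₀, X₁⟩` is known from the
  -- structure equations.
  · have h := hasLineDerivAt_log_sqrt
      (hasLineDerivAt_inner_covDerivCoord hQ (hX 1) (hX 1) hz 0) hGnn (hGne z hz)
    convert h using 1
    have h1 := (hframe z hz).inner_D₁X₀_X₁ (hF z hz) (hX₁ z hz)
    rw [real_inner_comm _ (coordField Φ 1 z), covDerivCoord_coordField_symm hQ hΦ hz 1 0, h1]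
    have h2 : ∀ k g : ℝ, g ≠ 0 → k = (k * g + k * g) / g / 2 := fun k g hg ↦ by
      field_simp
      ring
    exact h2 _ _ (hGne z hz)

end ConstantAngleSurface

end ConstantAngle

end

theorem theorem3p2
    {M : Type*} [EMetricSpace M] [ChartedSpace (EuclideanSpace ℝ (Fin 3)) M]
    [IsManifold (𝓡 3) ∞ M] [RiemannianBundle (fun x : M ↦ TangentSpace (𝓡 3) x)]
    [IsContMDiffRiemannianBundle (𝓡 3) ∞ (EuclideanSpace ℝ (Fin 3))
      (fun x : M ↦ TangentSpace (𝓡 3) x)]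
    [IsRiemannianManifold (𝓡 3) M] [CompleteSpace M]
    {N : Type*} [TopologicalSpace N] [T2Space N] [ChartedSpace (EuclideanSpace ℝ (Fin 2)) N]
    [IsManifold (𝓡 2) ∞ N]
    (V : ∀ x : M, TangentSpace (𝓡 3) x) (f : M → ℝ)
    (hV : ConstantAngle.IsAntiTorqued V f) (hVunit : ∀ x, ‖V x‖ = 1)
    (φ : N → M) (U : ∀ p, TangentSpace (𝓡 3) (φ p))
    (hφ : ConstantAngle.IsImmersedSurface φ U)
    (θ : ℝ) (hθ : ConstantAngle.IsConstantAngle φ U V θ) (p : N) :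
    (Real.cos θ = 0 ∧ ConstantAngle.IsRuledNear φ p) ∨
      (Real.cos θ ≠ 0 ∧ ConstantAngle.HasAdaptedCoordinatesNear φ U f θ p) := by
  exact ConstantAngle.isRuledNear_or_hasAdaptedCoordinatesNear hV hVunit hφ hθ p
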